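/- Let $(\Omega,\mathcal A,\wp)$ be a probability space, $H$ a separable complex Hilbert space, $(\Gamma,\Sigma)$ a measurable space, and let $L^0(\wp,H)$ be the space of ($\wp$-a.e. classes of) $H$-valued random variables with convergence in measure; $J_H:H\to L^0(\wp,H)$ embeds $H$ as the constant random variables. If a linear map $A:H\to L^0(\wp,H)$ is given by a family $a(\omega)$ of bounded operators on $H$, i.e. $(Ax)(\omega)=a(\omega)x$ a.e. for each $x\in H$, its decomposable extension is $\mathbf A:L^0(\wp,H)\to L^0(\wp,H)$, $(\mathbf Ag)(\omega)=a(\omega)g(\omega)$. A random projection operator is a continuous linear $P:H\to L^0(\wp,H)$ given by such a family, with $P=P^\bullet$ (that is: for $y\in H$ and $g\in L^0(\wp,H)$, $\langle (Px)(\omega),y\rangle=\langle x,g(\omega)\rangle$ a.e. for every $x\in H$ iff $g=Py$) and $\mathbf P P=P$. Let $E$ be a random projection operator valued measure: each $E(\sigma)$, $\sigma\in\Sigma$, is a random projection operator, $E(\Gamma)=J_H$, and $E(\bigcup_j\sigma_j)x=\sum_jE(\sigma_j)x$ a.e. for pairwise disjoint $\sigma_j\in\Sigma$ and $x\in H$.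 Write $\mathbf E(\sigma)$ for the decomposable extension of $E(\sigma)$. For bounded measurable $u:\Gamma\to\mathbb C$, $I(u):H\to L^0(\wp,H)$ and $\mathbf I(u):L^0(\wp,H)\to L^0(\wp,H)$ are the integrals of $u$ with respect to $E$ and $\mathbf E$, obtained from $I(\sum c_i\chi_{\sigma_i})=\sum c_iE(\sigma_i)$, $\mathbf I(\sum c_i\chi_{\sigma_i})=\sum c_i\mathbf E(\sigma_i)$ as a.e. limits along uniformly convergent sequences of simple functions. Let $f:\Gamma\to\mathbb C\cup\{\infty\}$ be measurable and $E$-a.e. finite, i.e. $E(\{f=\infty\})=0$. A bounding sequence for $f$ is an increasing sequence $(\sigma_n)$ in $\Sigma$ such that $f$ is bounded on each $\sigma_n$ and $E(\bigcup_n\sigma_n)=J_H$. Put $E^\omega_{g,g}(\sigma)=\langle(\mathbf E(\sigma)g)(\omega),g(\omega)\rangle$ for $g\in L^0(\wp,H)$ and $$\mathbf D(f)=\{g\in L^0(\wp,H): f\in L^2(E^\omega_{g,g})\text{ for a.e. }\omega\},\qquad D(f)=\{x\in H: f\in L^2(E^\omega_{x,x})\text{ for a.e. }\omega\},$$ where integrals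 with respect to $E^\omega_{g,g}$ are the a.e. defined limits of the integrals of simple functions increasing to the integrand. Then the integrals $I(u)$, $\mathbf I(u)$ above exist, and: (i) A vector $x\in H$ lies in $D(f)$ if and only if for each bounding sequence $(\sigma_n)$ for $f$ the sequence $I(f\chi_{\sigma_n})x(\omega)$ converges in $H$ for a.e. $\omega$. (ii) There is exactly one linear operator $\tilde I(f):D(f)\to L^0(\wp,H)$ with $\tilde I(f)x(\omega)=\lim_nI(f\chi_{\sigma_n})x(\omega)$ a.e. for every $x\in D(f)$ and every bounding sequence $(\sigma_n)$ for $f$; so the limit does not depend on the bounding sequence. Likewise there is exactly one linear operator $\tilde{\mathbf I}(f):\mathbf D(f)\to L^0(\wp,H)$ with $\tilde{\mathbf I}(f)g(\omega)=\lim_n\mathbf I(f\chi_{\sigma_n})g(\omega)$ a.e. for every $g\in\mathbf D(f)$ and every bounding sequence. For $\varphi\in L^0(\wp)$ and $g\in\mathbf D(f)$ one has $\varphi g\in\mathbf D(f)$ and $\tilde{\mathbf I}(f)(\varphi g)=\varphi\,\tilde{\mathbf I}(f)g$; and for $x\in H$, $x\in D(f)$ iff $J_Hx\in\mathbf D(f)$,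 in which case $\tilde I(f)x=\tilde{\mathbf I}(f)J_Hx$. (iii) Let $(\sigma_n)$ be a bounding sequence for $f$. Then $\bigcup_nE(\sigma_n)H\subseteq\mathbf D(f)$. The space $L^0(\wp)\otimes\bigcup_nE(\sigma_n)H$ of finite sums $\sum_j\varphi_jy_j$ with $\varphi_j\in L^0(\wp)$, $y_j\in\bigcup_nE(\sigma_n)H$, is a core for $\tilde{\mathbf I}(f)$: it lies in $\mathbf D(f)$ and $\tilde{\mathbf I}(f)$ is the closure (in $L^0(\wp,H)\times L^0(\wp,H)$) of its restriction to it. Moreover, for $x\in H$ and $h\in L^0(\wp,H)$: $x\in D(f)$ and $\tilde I(f)x=h$ if and only if $(J_Hx,h)$ lies in the closure of the graph of the restriction of $\tilde{\mathbf I}(f)$ to the set $\bigcup_nE(\sigma_n)H$. Finally, for each $n$, $$E(\sigma_n)\tilde I(f)\subseteq \tilde I(f)E(\sigma_n)=I(f\chi_{\sigma_n})$$ as operators from $H$ to $L^0(\wp,H)$ with natural domains, the products being $E(\sigma_n)\tilde I(f):=\mathbf E(\sigma_n)\circ\tilde I(f)$ and $\tilde I(f)E(\sigma_n):=\tilde{\mathbf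 I}(f)\circ E(\sigma_n)$. -/

import Mathlib

open MeasureTheory Filter Topology
open scoped ENNReal NNReal

namespace RandomOp

noncomputable section

section Basic

variable {Ω : Type*} [MeasurableSpace Ω] {P : Measure Ω}
  {H : Type*} [NormedAddCommGroup H] [InnerProductSpace ℂ H]

/-- The embedding of `H` into `L⁰(P, H)` (written `Ω →ₘ[P] H`) as constant random variables. -/
def constMap (P : Measure Ω) (H : Type*) [NormedAddCommGroup H] [InnerProductSpace ℂ H] :
    H →ₗ[ℂ] (Ω →ₘ[P] H) where
  toFun x := AEEqFun.const Ω x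
  map_add' _ _ := rfl
  map_smul' _ _ := rfl

/-- The everywhere defined linear map `A : H → L⁰(P, H)` is given by the family
`a(ω) ∈ B(H)`: for every `x`, `(A x)(ω) = a(ω) x` for almost all `ω`. -/
def IsDecomposedBy (A : H →ₗ[ℂ] (Ω →ₘ[P] H)) (a : Ω → H →L[ℂ] H) : Prop :=
  ∀ x : H, ∀ᵐ ω ∂P, A x ω = a ω x

/-- Pointwise application of a measurable family of continuous operators preserves
measurability. -/
theorem aestronglyMeasurable_apply (A : H →ₗ[ℂ] (Ω →ₘ[P] H)) (a : Ω → H →L[ℂ] H)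
    (h : IsDecomposedBy A a) (g : Ω →ₘ[P] H) :
    AEStronglyMeasurable (fun ω => a ω (g ω)) P := by
  have hg : StronglyMeasurable (g : Ω → H) := g.stronglyMeasurable
  have hs : ∀ s : SimpleFunc Ω H, AEStronglyMeasurable (fun ω => a ω (s ω)) P := by
    intro s
    have : (fun ω => a ω (s ω)) =
        fun ω => ∑ c ∈ s.range, (s ⁻¹' {c}).indicator (fun ω => a ω c) ω := by
      funext ω
      rw [Finset.sum_eq_single (s ω)]
      · simp
      · intro c _ hc
        rw [Set.indicator_of_notMem]
        simpa using fun e => hc e.symm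
      · intro hn
        exact absurd (SimpleFunc.mem_range_self s ω) hn
    rw [this]
    refine Finset.aestronglyMeasurable_fun_sum _ fun c _ => ?_
    refine AEStronglyMeasurable.indicator ?_ (s.measurableSet_fiber c)
    exact (A c).aestronglyMeasurable.congr (h c)
  refine aestronglyMeasurable_of_tendsto_ae atTop (fun n => hs (hg.approx n)) ?_
  exact Eventually.of_forall fun ω => ((a ω).continuous.tendsto _).comp (hg.tendsto_approx ω)

/-- The operator of pointwise application `L⁰(P, H) → L⁰(P, H)`, `g ↦ a(·) g(·)`, of a
measurable family of continuous operators. -/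
def pointwiseApply (A : H →ₗ[ℂ] (Ω →ₘ[P] H)) (a : Ω → H →L[ℂ] H)
    (h : IsDecomposedBy A a) : (Ω →ₘ[P] H) →ₗ[ℂ] (Ω →ₘ[P] H) where
  toFun g := AEEqFun.mk (fun ω => a ω (g ω)) (aestronglyMeasurable_apply A a h g)
  map_add' g g' := by
    rw [AEEqFun.mk_add_mk, AEEqFun.mk_eq_mk]
    filter_upwards [AEEqFun.coeFn_add g g'] with ω hω
    simp [hω]
  map_smul' c g := by
    refine AEEqFun.ext ?_
    filter_upwards [AEEqFun.coeFn_smul c g,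
      AEEqFun.coeFn_mk _ (aestronglyMeasurable_apply A a h (c • g)),
      AEEqFun.coeFn_smul c (AEEqFun.mk _ (aestronglyMeasurable_apply A a h g)),
      AEEqFun.coeFn_mk _ (aestronglyMeasurable_apply A a h g)] with ω h1 h2 h3 h4
    rw [RingHom.id_apply, h2, h3, h1, Pi.smul_apply, Pi.smul_apply, h4, map_smul]

open Classical in
/-- The decomposable extension of `A` to `L⁰(P, H)`: `(ext A g)(ω) = a(ω) g(ω)` for a family `a`
that decomposes `A`. -/
def ext (A : H →ₗ[ℂ] (Ω →ₘ[P] H)) : (Ω →ₘ[P] H) →ₗ[ℂ] (Ω →ₘ[P] H) :=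
  if h : ∃ a : Ω → H →L[ℂ] H, IsDecomposedBy A a then pointwiseApply A h.choose h.choose_spec
  else 0

/-- Random projection operators on `H`: continuous, decomposable by a family of continuous
operators, equal to the random adjoint, and idempotent for the random composition
`P P x = ext P (P x)`. -/
structure IsRandomProjection (A : H →ₗ[ℂ] (Ω →ₘ[P] H)) : Prop where
  continuous : ∀ (u : ℕ → H) (x : H), Tendsto u atTop (𝓝 x) →
    TendstoInMeasure P (fun k => (A (u k) : Ω → H)) atTop (A x)
  decomposable : ∃ a : Ω → H →L[ℂ] H, IsDecomposedBy A a
  /-- `y` is in the domain of the random adjoint with value `g` iff `g = A y`. -/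
  selfAdjoint : ∀ (y : H) (g : Ω →ₘ[P] H),
    (∀ x : H, ∀ᵐ ω ∂P, inner ℂ (A x ω) y = inner ℂ x (g ω)) ↔ g = A y
  idempotent : ∀ x : H, ext A (A x) = A x

theorem randComp_mem_left {V : Type*} [AddCommGroup V] [Module ℂ V]
    (B : (Ω →ₘ[P] H) →ₗ.[ℂ] (Ω →ₘ[P] H)) (A : V →ₗ.[ℂ] (Ω →ₘ[P] H)) {x : V}
    (hx : x ∈ (B.domain.comap A.toFun).map A.domain.subtype) : x ∈ A.domain := by
  obtain ⟨y, _, rfl⟩ := hx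
  exact y.2

theorem randComp_mem_right {V : Type*} [AddCommGroup V] [Module ℂ V]
    (B : (Ω →ₘ[P] H) →ₗ.[ℂ] (Ω →ₘ[P] H)) (A : V →ₗ.[ℂ] (Ω →ₘ[P] H)) {x : V}
    (hx : x ∈ (B.domain.comap A.toFun).map A.domain.subtype) :
    A ⟨x, randComp_mem_left B A hx⟩ ∈ B.domain := by
  obtain ⟨y, hy, rfl⟩ := hx
  exact hy

/-- Composition `B A` of `A` (from `V` to `H`) with an operator `B` in `L⁰(P, H)`, with its
natural domain `{x ∈ D(A) : A x ∈ D(B)}`. -/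
def randComp {V : Type*} [AddCommGroup V] [Module ℂ V]
    (B : (Ω →ₘ[P] H) →ₗ.[ℂ] (Ω →ₘ[P] H)) (A : V →ₗ.[ℂ] (Ω →ₘ[P] H)) :
    V →ₗ.[ℂ] (Ω →ₘ[P] H) where
  domain := (B.domain.comap A.toFun).map A.domain.subtype
  toFun :=
    { toFun := fun x => B ⟨A ⟨x, randComp_mem_left B A x.2⟩, randComp_mem_right B A x.2⟩
      map_add' := fun x y => by
        rw [← B.map_add]
        exact congrArg B (Subtype.ext (A.map_add ⟨x, randComp_mem_left B A x.2⟩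
          ⟨y, randComp_mem_left B A y.2⟩))
      map_smul' := fun c x => by
        rw [RingHom.id_apply, ← B.map_smul]
        exact congrArg B (Subtype.ext (A.map_smul c ⟨x, randComp_mem_left B A x.2⟩)) }

/-- The closure of a subset of `L⁰(P, H) × L⁰(P, H)` for convergence in measure (which is
metrizable, so that sequences suffice). -/
def closureInMeasure (S : Set ((Ω →ₘ[P] H) × (Ω →ₘ[P] H))) :
    Set ((Ω →ₘ[P] H) × (Ω →ₘ[P] H)) :=
  {p | ∃ u : ℕ → (Ω →ₘ[P] H) × (Ω →ₘ[P] H), (∀ k, u k ∈ S) ∧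
    TendstoInMeasure P (fun k => ((u k).1 : Ω → H)) atTop p.1 ∧
    TendstoInMeasure P (fun k => ((u k).2 : Ω → H)) atTop p.2}

/-- `D` is a core for the operator `T` in `L⁰(P, H)`: `D ⊆ D(T)` and `T` is the closure of
`T|_D`. (In particular `T` is closed.) -/
def IsCore (T : (Ω →ₘ[P] H) →ₗ.[ℂ] (Ω →ₘ[P] H)) (D : Submodule ℂ (Ω →ₘ[P] H)) : Prop :=
  D ≤ T.domain ∧
    (T.graph : Set ((Ω →ₘ[P] H) × (Ω →ₘ[P] H))) = closureInMeasure (T.domRestrict D).graph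

/-- Multiplication of an `H`-valued random variable by a scalar random variable. -/
def scalarMul (φ : Ω →ₘ[P] ℂ) (g : Ω →ₘ[P] H) : Ω →ₘ[P] H :=
  AEEqFun.comp₂ (fun (c : ℂ) (x : H) => c • x) continuous_smul φ g

end Basic

/-- Random projection operator valued measures on `(Γ, Σ, H)`. Only the values on measurable sets
matter. -/
structure RandomSpectralMeasure (Γ : Type*) [MeasurableSpace Γ] {Ω : Type*} [MeasurableSpace Ω]
    (P : Measure Ω) (H : Type*) [NormedAddCommGroup H] [InnerProductSpace ℂ H] where
  toFun : Set Γ → H →ₗ[ℂ] (Ω →ₘ[P] H)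
  isRandomProjection : ∀ σ, MeasurableSet σ → IsRandomProjection (toFun σ)
  iUnion : ∀ σ : ℕ → Set Γ, (∀ j, MeasurableSet (σ j)) → Pairwise (Function.onFun Disjoint σ) →
    ∀ x : H, ∀ᵐ ω ∂P,
      Tendsto (fun n => ∑ j ∈ Finset.range n, toFun (σ j) x ω) atTop (𝓝 (toFun (⋃ j, σ j) x ω))
  univ : toFun Set.univ = constMap P H

section Integral

/- The integrals are built for a family `F` of linear maps `F(σ) : V → L⁰(P, H)`, to be used with
`V = H`, `F = E` and with `V = L⁰(P, H)`, `F(σ) = ext (E σ)`. -/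

variable {Γ : Type*} [MeasurableSpace Γ] {Ω : Type*} [MeasurableSpace Ω] {P : Measure Ω}
  {H : Type*} [NormedAddCommGroup H] [InnerProductSpace ℂ H]
  {V : Type*} [AddCommGroup V] [Module ℂ V]

/-- `I(s) = ∑ c, c F(s = c)` for a simple function `s`. -/
def simpleIntegral (F : Set Γ → V →ₗ[ℂ] (Ω →ₘ[P] H)) (s : SimpleFunc Γ ℂ) :
    V →ₗ[ℂ] (Ω →ₘ[P] H) :=
  ∑ c ∈ s.range, c • F (s ⁻¹' {c})

/-- `A` is the integral of the bounded function `u`: `A v = lim I(s_k) v` a.e. whenever the simple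
functions `s_k` converge uniformly to `u`. -/
def IsBoundedIntegral (F : Set Γ → V →ₗ[ℂ] (Ω →ₘ[P] H)) (u : Γ → ℂ)
    (A : V →ₗ[ℂ] (Ω →ₘ[P] H)) : Prop :=
  ∀ s : ℕ → SimpleFunc Γ ℂ, TendstoUniformly (fun k γ => s k γ) u atTop →
    ∀ v : V, ∀ᵐ ω ∂P, Tendsto (fun k => simpleIntegral F (s k) v ω) atTop (𝓝 (A v ω))

open Classical in
/-- The integral `I(u)` of a bounded measurable function. -/
def integral (F : Set Γ → V →ₗ[ℂ] (Ω →ₘ[P] H)) (u : Γ → ℂ) : V →ₗ[ℂ] (Ω →ₘ[P] H) :=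
  if h : ∃ A, IsBoundedIntegral F u A then h.choose else 0

/-- The integral `∫ u dm^ω` of `u ≥ 0` for a random positive measure `m`, through the canonical
increasing sequence of simple functions with supremum `u`; since `m` is only defined and additive
up to null sets which depend on the sets involved, it is defined for almost all `ω`. -/
def randomLIntegral (m : Set Γ → Ω → ℝ) (u : Γ → ℝ≥0∞) (ω : Ω) : ℝ≥0∞ :=
  ⨆ n : ℕ, ∑ c ∈ (SimpleFunc.eapprox u n).range,
    c * ENNReal.ofReal (m (SimpleFunc.eapprox u n ⁻¹' {c}) ω)

/-- The absolute value on `ℂ ∪ {∞}`. -/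
def absInfty (z : OnePoint ℂ) : ℝ≥0∞ := z.elim ∞ fun w => ‖w‖ₑ

/-- `f χ_σ`, for `f` finite on `σ`. -/
def trunc (f : Γ → OnePoint ℂ) (σ : Set Γ) : Γ → ℂ :=
  σ.indicator fun γ => (f γ).elim 0 id

/-- `f ∈ L²(E^ω_{v,v})` for almost all `ω`, where
`E^ω_{v,v}(σ) = ⟨(F(σ) v)(ω), (J v)(ω)⟩`, `J` being the embedding of `V` into `L⁰(P, H)`. -/
def MemL2 (J : V →ₗ[ℂ] (Ω →ₘ[P] H)) (F : Set Γ → V →ₗ[ℂ] (Ω →ₘ[P] H)) (f : Γ → OnePoint ℂ)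
    (v : V) : Prop :=
  ∀ᵐ ω ∂P, randomLIntegral (fun σ ω => (inner ℂ (J v ω) (F σ v ω)).re)
    (fun γ => absInfty (f γ) ^ 2) ω < ∞

/-- Bounding sequences for `f`. -/
structure IsBoundingSeq (E : RandomSpectralMeasure Γ P H) (f : Γ → OnePoint ℂ)
    (σ : ℕ → Set Γ) : Prop where
  measurableSet : ∀ n, MeasurableSet (σ n)
  bounded : ∀ n, ∃ C : ℝ≥0, ∀ γ ∈ σ n, absInfty (f γ) ≤ C
  mono : ∀ n, σ n ⊆ σ (n + 1)
  iUnion : E.toFun (⋃ n, σ n) = constMap P H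

/-- `T` has the domain `{v : f ∈ L²(E^ω_{v,v}) a.e.}` and, for every bounding sequence,
`T v (ω) = lim I(f χ_{σ_n}) v (ω)` a.e. on it. -/
def IsUnboundedIntegral (E : RandomSpectralMeasure Γ P H) (J : V →ₗ[ℂ] (Ω →ₘ[P] H))
    (F : Set Γ → V →ₗ[ℂ] (Ω →ₘ[P] H)) (f : Γ → OnePoint ℂ)
    (T : V →ₗ.[ℂ] (Ω →ₘ[P] H)) : Prop :=
  (∀ v, v ∈ T.domain ↔ MemL2 J F f v) ∧
    ∀ (v : T.domain) (σ : ℕ → Set Γ), IsBoundingSeq E f σ →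
      ∀ᵐ ω ∂P, Tendsto (fun n => integral F (trunc f (σ n)) (v : V) ω) atTop (𝓝 (T v ω))

/-- The decomposable extensions of the projections `E(σ)`. -/
def extFamily (E : RandomSpectralMeasure Γ P H) (σ : Set Γ) :
    (Ω →ₘ[P] H) →ₗ[ℂ] (Ω →ₘ[P] H) :=
  ext (E.toFun σ)

/-- `Ĩ(f)`, as an operator from `H` to `L⁰(P, H)`. -/
def IsRandomIntegral (E : RandomSpectralMeasure Γ P H) (f : Γ → OnePoint ℂ)
    (T : H →ₗ.[ℂ] (Ω →ₘ[P] H)) : Prop :=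
  IsUnboundedIntegral E (constMap P H) E.toFun f T

/-- The pointwise action of `Ĩ(f)` on random vectors, as an operator in `L⁰(P, H)`, with domain
`{g : f ∈ L²(E^ω_{g(ω),g(ω)}) a.e.}`. -/
def IsExtRandomIntegral (E : RandomSpectralMeasure Γ P H) (f : Γ → OnePoint ℂ)
    (T : (Ω →ₘ[P] H) →ₗ.[ℂ] (Ω →ₘ[P] H)) : Prop :=
  IsUnboundedIntegral E LinearMap.id (extFamily E) f T

/-- The set `⋃ₙ E(σₙ)H` of random vectors. -/
def unionRange (E : RandomSpectralMeasure Γ P H) (σ : ℕ → Set Γ) : Set (Ω →ₘ[P] H) :=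
  {g | ∃ (n : ℕ) (x : H), g = E.toFun (σ n) x}

/-- `L⁰(P) ⊗ ⋃ₙ E(σₙ)H`: the finite sums `∑ φ_j y_j` with `φ_j ∈ L⁰(P)`, `y_j ∈ ⋃ₙ E(σₙ)H`. -/
def tensorUnionRange (E : RandomSpectralMeasure Γ P H) (σ : ℕ → Set Γ) :
    Submodule ℂ (Ω →ₘ[P] H) :=
  Submodule.span ℂ {g | ∃ (φ : Ω →ₘ[P] ℂ) (y : Ω →ₘ[P] H), y ∈ unionRange E σ ∧ g = scalarMul φ y}

end Integral

end

end RandomOp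

/-! Away from null sets, $E$ is a projection valued measure with values in $B(H)$, so the classical
spectral calculus should apply at each $\omega$. The obstacle is that every identity holds only
outside a null set depending on the sets or functions in it. Separability merges the null sets
belonging to different vectors, since a dense sequence determines an operator; after that, only
countably many sets and functions are used at a time.

Bounded calculus: a.e., $u\mapsto I(u)$ is multiplicative on simple functions, respects adjoints and
is bounded by the sup norm (`simpleOp_mul`, `star_simpleOp`, `norm_simpleOp_le`). It therefore
extends by norm limits to bounded measurable functions (`tendsto_bddOp`), with $\langle x,
I(|u|^2)x\rangle = \|I(u)x\|^2$.

Domain: the vectors $y_n = I(f\chi_{\sigma_n})x$ satisfy $E(\sigma_m)y_n = y_m$ for $m\le n$, so by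
Pythagoras they converge iff they are bounded. Since $\|y_n\|^2$ is the integral of
$|f|^2\chi_{\sigma_n}$, boundedness means $f\in L^2$ (`IsBoundingSeq.memL2_iff`).

Limit operator: $h=\lim_n I(f\chi_{\sigma_n})g$ holds iff $E(\tau_n)h = I(f\chi_{\tau_n})g$ for all
$n$, where $(\tau_n)$ may be any bounding sequence (`IsLim.projFamily_apply`,
`isLim_of_projFamily_apply`). These are countably many equations between bounded operators. They
give independence of the bounding sequence, closedness for convergence in measure, and the product
relations with $E(\sigma_n)$.

Core: $g$ is approximated by $E(\sigma_n)s_{k(n)}$ with simple $s_k\to g$, where $k(n)$ grows fast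
enough to offset the growth of $I(f\chi_{\sigma_n})$ (`exists_subseq_ae_tendsto_sub`,
`IsLim.exists_tendsto`). -/

namespace RandomOp

noncomputable section

/-! ### Algebra of the projections $E(\sigma)(\omega)$, almost everywhere. -/

section Projections

variable {Γ : Type*} [MeasurableSpace Γ] {Ω : Type*} [MeasurableSpace Ω] {P : Measure Ω}
  {H : Type*} [NormedAddCommGroup H] [InnerProductSpace ℂ H]

theorem constMap_apply_ae (P : Measure Ω) (x : H) : ∀ᵐ ω ∂P, constMap P H x ω = x :=
  AEEqFun.coeFn_const Ω x

open Classical in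
/-- A family of bounded operators which decomposes `E(σ)`. -/
def projFamily (E : RandomSpectralMeasure Γ P H) (σ : Set Γ) : Ω → H →L[ℂ] H :=
  if h : ∃ a : Ω → H →L[ℂ] H, IsDecomposedBy (E.toFun σ) a then h.choose else 0

theorem isDecomposedBy_projFamily (E : RandomSpectralMeasure Γ P H) {σ : Set Γ}
    (hσ : MeasurableSet σ) : IsDecomposedBy (E.toFun σ) (projFamily E σ) := by
  have h := (E.isRandomProjection σ hσ).decomposable
  rw [projFamily, dif_pos h]
  exact h.choose_spec

theorem extFamily_apply_ae (E : RandomSpectralMeasure Γ P H) {σ : Set Γ}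
    (hσ : MeasurableSet σ) (g : Ω →ₘ[P] H) :
    ∀ᵐ ω ∂P, extFamily E σ g ω = projFamily E σ ω (g ω) := by
  have h := (E.isRandomProjection σ hσ).decomposable
  rw [extFamily, ext, projFamily, dif_pos h, dif_pos h]
  exact AEEqFun.coeFn_mk _ _

theorem extFamily_constMap (E : RandomSpectralMeasure Γ P H) {σ : Set Γ}
    (hσ : MeasurableSet σ) (x : H) : extFamily E σ (constMap P H x) = E.toFun σ x := by
  refine AEEqFun.ext ?_
  filter_upwards [extFamily_apply_ae E hσ (constMap P H x), isDecomposedBy_projFamily E hσ x,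
    constMap_apply_ae P x] with ω h1 h2 h3
  rw [h1, h2, h3]

/-- The null sets attached to a dense sequence of vectors have a null union, and continuity covers
the remaining vectors. Relations between random projections thereby become relations in $B(H)$,
which can be applied to random vectors. -/
theorem ae_eq_of_forall_apply [TopologicalSpace.SeparableSpace H] {a b : Ω → H →L[ℂ] H}
    (h : ∀ x, ∀ᵐ ω ∂P, a ω x = b ω x) : ∀ᵐ ω ∂P, a ω = b ω := by
  have : ∀ᵐ ω ∂P, ∀ n, a ω (TopologicalSpace.denseSeq H n) = b ω (TopologicalSpace.denseSeq H n) :=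
    ae_all_iff.2 fun n => h _
  filter_upwards [this] with ω hω
  refine DFunLike.coe_injective
    ((TopologicalSpace.denseRange_denseSeq H).equalizer (a ω).continuous (b ω).continuous ?_)
  exact funext hω

variable [TopologicalSpace.SeparableSpace H]

theorem projFamily_mul_self (E : RandomSpectralMeasure Γ P H) {σ : Set Γ}
    (hσ : MeasurableSet σ) : ∀ᵐ ω ∂P, projFamily E σ ω * projFamily E σ ω = projFamily E σ ω := by
  refine ae_eq_of_forall_apply fun x => ?_
  have h := (E.isRandomProjection σ hσ).idempotent x
  have h1 := extFamily_apply_ae E hσ (E.toFun σ x)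
  rw [extFamily, h] at h1
  filter_upwards [h1, isDecomposedBy_projFamily E hσ x] with ω h2 h3
  rw [mul_apply_eq_comp, ← h3, ← h2]

theorem projFamily_univ (E : RandomSpectralMeasure Γ P H) :
    ∀ᵐ ω ∂P, projFamily E Set.univ ω = 1 := by
  refine ae_eq_of_forall_apply fun x => ?_
  have h := isDecomposedBy_projFamily E MeasurableSet.univ x
  rw [E.univ] at h
  filter_upwards [h, constMap_apply_ae P x] with ω h1 h2
  rw [← h1, h2, one_apply_eq_self]

theorem projFamily_empty (E : RandomSpectralMeasure Γ P H) :
    ∀ᵐ ω ∂P, projFamily E ∅ ω = 0 := by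
  refine ae_eq_of_forall_apply fun x => ?_
  have h := E.iUnion (fun _ => ∅) (fun _ => MeasurableSet.empty)
    (fun _ _ _ => Set.disjoint_empty _) x
  filter_upwards [h, isDecomposedBy_projFamily E MeasurableSet.empty x] with ω h1 h2
  simp only [Set.iUnion_empty, Finset.sum_const, Finset.card_range] at h1
  -- The partial sums are $n\,E(\emptyset)x$. They converge, so their constant increment
  -- $E(\emptyset)x$ tends to zero.
  have h3 := ((tendsto_add_atTop_iff_nat 1).2 h1).sub h1
  simp only [add_smul, one_smul, add_sub_cancel_left, sub_self] at h3
  rw [← h2, tendsto_nhds_unique tendsto_const_nhds h3]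
  rfl

theorem projFamily_union (E : RandomSpectralMeasure Γ P H) {σ τ : Set Γ}
    (hσ : MeasurableSet σ) (hτ : MeasurableSet τ) (hd : Disjoint σ τ) :
    ∀ᵐ ω ∂P, projFamily E (σ ∪ τ) ω = projFamily E σ ω + projFamily E τ ω := by
  refine ae_eq_of_forall_apply fun x => ?_
  let s : ℕ → Set Γ := fun n => if n = 0 then σ else if n = 1 then τ else ∅
  have hs : ∀ n, MeasurableSet (s n) := fun n => by
    dsimp only [s]; split_ifs <;> simp [hσ, hτ]
  have hU : ⋃ n, s n = σ ∪ τ := by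
    ext γ
    simp only [Set.mem_iUnion, Set.mem_union, s]
    constructor
    · rintro ⟨n, hn⟩
      split_ifs at hn <;> simp_all
    · rintro (h | h)
      · exact ⟨0, by simpa using h⟩
      · exact ⟨1, by simpa using h⟩
  have h := E.iUnion s hs (fun i j hij => by
    dsimp only [Function.onFun, s]
    split_ifs <;> simp_all [disjoint_comm]) x
  rw [hU] at h
  filter_upwards [h, isDecomposedBy_projFamily E hσ x, isDecomposedBy_projFamily E hτ x,
    isDecomposedBy_projFamily E (hσ.union hτ) x, isDecomposedBy_projFamily E MeasurableSet.empty x,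
    projFamily_empty E] with ω h1 h2 h3 h4 h5 h6
  rw [h6] at h5
  have h7 : Tendsto (fun n => ∑ j ∈ Finset.range n, E.toFun (s j) x ω) atTop
      (𝓝 (E.toFun σ x ω + E.toFun τ x ω)) := by
    refine tendsto_const_nhds.congr' ?_
    filter_upwards [eventually_ge_atTop 2] with n hn
    obtain ⟨k, rfl⟩ := Nat.exists_eq_add_of_le hn
    rw [Finset.sum_range_add, Finset.sum_eq_zero (s := Finset.range k)]
    · simp [Finset.sum_range_succ, s]
    · intro j _
      have : s (2 + j) = ∅ := by
        dsimp only [s]; rw [if_neg (by omega), if_neg (by omega)]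
      rw [this, h5]; rfl
  rw [add_apply, ← h2, ← h3, ← h4]
  exact tendsto_nhds_unique h1 h7

theorem projFamily_biUnion (E : RandomSpectralMeasure Γ P H) {ι : Type*} (t : Finset ι)
    (σ : ι → Set Γ) (hσ : ∀ i, MeasurableSet (σ i))
    (hd : Pairwise (Function.onFun Disjoint σ)) :
    ∀ᵐ ω ∂P, projFamily E (⋃ i ∈ t, σ i) ω = ∑ i ∈ t, projFamily E (σ i) ω := by
  classical
  induction t using Finset.induction_on with
  | empty => simpa using projFamily_empty E
  | insert i t hi ih =>
    have hdis : Disjoint (σ i) (⋃ j ∈ t, σ j) := by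
      simp only [Set.disjoint_iUnion_right]
      exact fun j hj => hd fun e => hi (e ▸ hj)
    filter_upwards [ih, projFamily_union E (hσ i) (t.measurableSet_biUnion fun j _ => hσ j) hdis]
      with ω h1 h2
    rw [Finset.set_biUnion_insert, h2, h1, Finset.sum_insert hi]

/-- Idempotence of $p$, $q$ and $p+q$ gives $pq+qp=0$. Multiplying by $p$ on the left and on the
right yields $pq=-pqp=qp$, hence $2pq=0$. -/
theorem projFamily_mul_of_disjoint (E : RandomSpectralMeasure Γ P H) {σ τ : Set Γ}
    (hσ : MeasurableSet σ) (hτ : MeasurableSet τ) (hd : Disjoint σ τ) :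
    ∀ᵐ ω ∂P, projFamily E σ ω * projFamily E τ ω = 0 := by
  filter_upwards [projFamily_union E hσ hτ hd, projFamily_mul_self E hσ, projFamily_mul_self E hτ,
    projFamily_mul_self E (hσ.union hτ)] with ω h1 h2 h3 h4
  rw [h1] at h4
  set p := projFamily E σ ω
  set q := projFamily E τ ω
  have h5 : p * q + q * p = 0 := by
    have : (p + q) * (p + q) = p * p + q * q + (p * q + q * p) := by noncomm_ring
    rw [this, h2, h3] at h4
    simpa using h4
  have h6 : p * q + p * q * p = 0 := by
    calc p * q + p * q * p = (p * p) * q + p * q * p := by rw [h2]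
      _ = p * (p * q + q * p) := by noncomm_ring
      _ = 0 := by rw [h5, mul_zero]
  have h7 : p * q * p + q * p = 0 := by
    calc p * q * p + q * p = p * q * p + q * (p * p) := by rw [h2]
      _ = (p * q + q * p) * p := by noncomm_ring
      _ = 0 := by rw [h5, zero_mul]
  have h8 : (2 : ℂ) • (p * q) = 0 := by
    have : (2 : ℂ) • (p * q)
        = (p * q + q * p) + (p * q + p * q * p) - (p * q * p + q * p) := by
      rw [two_smul]; abel
    rw [this, h5, h6, h7]; simp
  simpa using h8

variable [CompleteSpace H]

theorem star_projFamily (E : RandomSpectralMeasure Γ P H) {σ : Set Γ}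
    (hσ : MeasurableSet σ) : ∀ᵐ ω ∂P, star (projFamily E σ ω) = projFamily E σ ω := by
  refine ae_eq_of_forall_apply fun y => ?_
  have h : ∀ᵐ ω ∂P, ∀ n, inner ℂ (E.toFun σ (TopologicalSpace.denseSeq H n) ω) y
      = inner ℂ (TopologicalSpace.denseSeq H n) (E.toFun σ y ω) :=
    ae_all_iff.2 fun n => ((E.isRandomProjection σ hσ).selfAdjoint y _).2 rfl _
  have h' : ∀ᵐ ω ∂P, ∀ n, E.toFun σ (TopologicalSpace.denseSeq H n) ω
      = projFamily E σ ω (TopologicalSpace.denseSeq H n) :=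
    ae_all_iff.2 fun n => isDecomposedBy_projFamily E hσ _
  filter_upwards [h, h', isDecomposedBy_projFamily E hσ y] with ω h1 h2 h3
  rw [← h3, ContinuousLinearMap.star_eq_adjoint]
  refine ext_inner_left ℂ fun x => ?_
  rw [ContinuousLinearMap.adjoint_inner_right]
  revert x
  refine congrFun ((TopologicalSpace.denseRange_denseSeq H).equalizer
    (by fun_prop) (by fun_prop) (funext fun n => ?_))
  simp only [Function.comp_apply]
  rw [← h2, h1]

end Projections

/-! ### Calculus for simple functions. -/

section SimpleOperators

variable {Γ : Type*} [MeasurableSpace Γ] {Ω : Type*} [MeasurableSpace Ω] {P : Measure Ω}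
  {H : Type*} [NormedAddCommGroup H] [InnerProductSpace ℂ H]

/-- The operators `∑ c, c E(s = c)(ω)`. -/
def simpleOp (E : RandomSpectralMeasure Γ P H) (s : SimpleFunc Γ ℂ) (ω : Ω) : H →L[ℂ] H :=
  ∑ c ∈ s.range, c • projFamily E (s ⁻¹' {c}) ω

theorem simpleIntegral_apply_ae {V : Type*} [AddCommGroup V] [Module ℂ V]
    (F : Set Γ → V →ₗ[ℂ] (Ω →ₘ[P] H)) (s : SimpleFunc Γ ℂ) (v : V) :
    ∀ᵐ ω ∂P, simpleIntegral F s v ω = ∑ c ∈ s.range, c • F (s ⁻¹' {c}) v ω := by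
  have h : simpleIntegral F s v = ∑ c ∈ s.range, c • F (s ⁻¹' {c}) v := by
    simp [simpleIntegral]
  rw [h]
  have h2 : ∀ᵐ ω ∂P, ∀ c ∈ s.range, (c • F (s ⁻¹' {c}) v) ω = c • F (s ⁻¹' {c}) v ω :=
    (Finset.eventually_all s.range).2 fun c _ => AEEqFun.coeFn_smul c _
  filter_upwards [AEEqFun.coeFn_finsetSum s.range fun c => c • F (s ⁻¹' {c}) v, h2] with ω h3 h4
  rw [h3, Finset.sum_apply]
  exact Finset.sum_congr rfl h4

theorem simpleIntegral_toFun (E : RandomSpectralMeasure Γ P H) (s : SimpleFunc Γ ℂ) (x : H) :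
    ∀ᵐ ω ∂P, simpleIntegral E.toFun s x ω = simpleOp E s ω x := by
  have h : ∀ᵐ ω ∂P, ∀ c ∈ s.range, E.toFun (s ⁻¹' {c}) x ω = projFamily E (s ⁻¹' {c}) ω x :=
    (Finset.eventually_all s.range).2 fun c _ =>
      isDecomposedBy_projFamily E (s.measurableSet_fiber c) x
  filter_upwards [simpleIntegral_apply_ae E.toFun s x, h] with ω h1 h2
  rw [h1, simpleOp, sum_apply]
  exact Finset.sum_congr rfl fun c hc => by rw [h2 c hc]; rfl

theorem simpleIntegral_extFamily (E : RandomSpectralMeasure Γ P H) (s : SimpleFunc Γ ℂ)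
    (g : Ω →ₘ[P] H) :
    ∀ᵐ ω ∂P, simpleIntegral (extFamily E) s g ω = simpleOp E s ω (g ω) := by
  have h : ∀ᵐ ω ∂P, ∀ c ∈ s.range,
      extFamily E (s ⁻¹' {c}) g ω = projFamily E (s ⁻¹' {c}) ω (g ω) :=
    (Finset.eventually_all s.range).2 fun c _ => extFamily_apply_ae E (s.measurableSet_fiber c) g
  filter_upwards [simpleIntegral_apply_ae (extFamily E) s g, h] with ω h1 h2
  rw [h1, simpleOp, sum_apply]
  exact Finset.sum_congr rfl fun c hc => by rw [h2 c hc]; rfl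

variable [TopologicalSpace.SeparableSpace H]

/-- Each fibre of the composite is a finite disjoint union of fibres of `p`. With `p` a pair of
simple functions, both can be expanded over one common partition, which reduces sums and products to
finite algebra. -/
theorem simpleOp_map (E : RandomSpectralMeasure Γ P H) {β : Type*} (p : SimpleFunc Γ β)
    (φ : β → ℂ) : ∀ᵐ ω ∂P,
      simpleOp E (p.map φ) ω = ∑ z ∈ p.range, φ z • projFamily E (p ⁻¹' {z}) ω := by
  classical
  have h : ∀ᵐ ω ∂P, ∀ c ∈ (p.map φ).range, projFamily E (p.map φ ⁻¹' {c}) ω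
      = ∑ z ∈ p.range with φ z = c, projFamily E (p ⁻¹' {z}) ω := by
    refine (Finset.eventually_all _).2 fun c _ => ?_
    have hU : p.map φ ⁻¹' {c} = ⋃ z ∈ p.range.filter (fun z => φ z = c), p ⁻¹' {z} := by
      ext γ
      simp
    rw [hU]
    refine projFamily_biUnion E _ _ (fun z => p.measurableSet_fiber z) fun z w hzw => ?_
    exact Disjoint.preimage _ (Set.disjoint_singleton.2 hzw)
  filter_upwards [h] with ω h1
  rw [simpleOp, Finset.sum_congr rfl fun c hc => by rw [h1 c hc, Finset.smul_sum]]
  rw [← Finset.sum_fiberwise_of_maps_to (s := p.range) (t := (p.map φ).range) (g := φ)]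
  · refine Finset.sum_congr rfl fun c _ => Finset.sum_congr rfl fun z hz => ?_
    rw [(Finset.mem_filter.1 hz).2]
  · intro z hz
    rw [SimpleFunc.range_map]
    exact Finset.mem_image_of_mem _ hz

theorem simpleOp_indicator (E : RandomSpectralMeasure Γ P H) {σ : Set Γ}
    (hσ : MeasurableSet σ) : ∀ᵐ ω ∂P,
      simpleOp E (SimpleFunc.piecewise σ hσ (SimpleFunc.const Γ 1) (SimpleFunc.const Γ 0)) ω
        = projFamily E σ ω := by
  classical
  set s := SimpleFunc.piecewise σ hσ (SimpleFunc.const Γ (1 : ℂ)) (SimpleFunc.const Γ 0)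
  have h1 : s ⁻¹' {1} = σ := by
    ext γ
    by_cases hγ : γ ∈ σ <;> simp [s, hγ]
  have hr : s.range ⊆ {0, 1} := by
    intro c hc
    obtain ⟨γ, rfl⟩ := SimpleFunc.mem_range.1 hc
    by_cases hγ : γ ∈ σ <;> simp [s, hγ]
  -- If `σ` is empty, the value 1 is missing from the range of `s`, so the term added for it must
  -- vanish.
  have h : ∀ᵐ ω ∂P, s ⁻¹' {1} = ∅ → projFamily E (s ⁻¹' {1}) ω = 0 := by
    by_cases he : s ⁻¹' {1} = ∅
    · rw [he]
      filter_upwards [projFamily_empty E] with ω hω _ using hω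
    · exact Eventually.of_forall fun ω h => absurd h he
  filter_upwards [h] with ω hω
  rw [simpleOp, Finset.sum_subset hr, Finset.sum_pair zero_ne_one, zero_smul, zero_add, one_smul,
    h1]
  intro c hc hcr
  have : s ⁻¹' {c} = ∅ := by
    rw [SimpleFunc.preimage_eq_empty_iff]
    simpa using hcr
  rcases Finset.mem_insert.1 hc with rfl | hc
  · rw [zero_smul]
  · rw [Finset.mem_singleton] at hc
    subst hc
    rw [hω this, smul_zero]

theorem simpleOp_add (E : RandomSpectralMeasure Γ P H) (s t : SimpleFunc Γ ℂ) :
    ∀ᵐ ω ∂P, simpleOp E (s + t) ω = simpleOp E s ω + simpleOp E t ω := by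
  filter_upwards [simpleOp_map E (s.pair t) Prod.fst, simpleOp_map E (s.pair t) Prod.snd,
    simpleOp_map E (s.pair t) fun z => z.1 + z.2] with ω h1 h2 h3
  rw [SimpleFunc.map_fst_pair] at h1
  rw [SimpleFunc.map_snd_pair] at h2
  rw [SimpleFunc.add_eq_map₂, h3, h1, h2, ← Finset.sum_add_distrib]
  simp_rw [add_smul]

theorem simpleOp_smul (E : RandomSpectralMeasure Γ P H) (c : ℂ) (s : SimpleFunc Γ ℂ) :
    ∀ᵐ ω ∂P, simpleOp E (c • s) ω = c • simpleOp E s ω := by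
  filter_upwards [simpleOp_map E s (c • ·)] with ω h
  rw [SimpleFunc.smul_eq_map, h, simpleOp, Finset.smul_sum]
  simp_rw [smul_smul, smul_eq_mul]

theorem simpleOp_mul (E : RandomSpectralMeasure Γ P H) (s t : SimpleFunc Γ ℂ) :
    ∀ᵐ ω ∂P, simpleOp E (s * t) ω = simpleOp E s ω * simpleOp E t ω := by
  set p := s.pair t
  have hdis : ∀ᵐ ω ∂P, ∀ z ∈ p.range, ∀ w ∈ p.range, z ≠ w →
      projFamily E (p ⁻¹' {z}) ω * projFamily E (p ⁻¹' {w}) ω = 0 := by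
    refine (Finset.eventually_all _).2 fun z _ => (Finset.eventually_all _).2 fun w _ => ?_
    by_cases hzw : z = w
    · exact Eventually.of_forall fun ω h => absurd hzw h
    · filter_upwards [projFamily_mul_of_disjoint E (p.measurableSet_fiber z)
        (p.measurableSet_fiber w) (Disjoint.preimage _ (Set.disjoint_singleton.2 hzw))]
        with ω h _ using h
  have hid : ∀ᵐ ω ∂P, ∀ z ∈ p.range,
      projFamily E (p ⁻¹' {z}) ω * projFamily E (p ⁻¹' {z}) ω = projFamily E (p ⁻¹' {z}) ω :=
    (Finset.eventually_all _).2 fun z _ => projFamily_mul_self E (p.measurableSet_fiber z)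
  filter_upwards [simpleOp_map E p Prod.fst, simpleOp_map E p Prod.snd,
    simpleOp_map E p fun z => z.1 * z.2, hdis, hid] with ω h1 h2 h3 h4 h5
  rw [SimpleFunc.map_fst_pair] at h1
  rw [SimpleFunc.map_snd_pair] at h2
  rw [SimpleFunc.mul_eq_map₂, h3, h1, h2, Finset.sum_mul_sum]
  refine Finset.sum_congr rfl fun z hz => ?_
  rw [Finset.sum_eq_single_of_mem z hz]
  · rw [smul_mul_smul_comm, h5 z hz]
  · intro w hw hwz
    rw [smul_mul_smul_comm, h4 z hz w hw hwz.symm, smul_zero]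

theorem simpleOp_const (E : RandomSpectralMeasure Γ P H) (c : ℂ) :
    ∀ᵐ ω ∂P, simpleOp E (SimpleFunc.const Γ c) ω = c • 1 := by
  have h : SimpleFunc.const Γ c = c • SimpleFunc.piecewise Set.univ MeasurableSet.univ
      (SimpleFunc.const Γ 1) (SimpleFunc.const Γ 0) := by
    ext γ
    simp
  filter_upwards [simpleOp_smul E c (SimpleFunc.piecewise Set.univ MeasurableSet.univ
    (SimpleFunc.const Γ 1) (SimpleFunc.const Γ 0)), simpleOp_indicator E MeasurableSet.univ,
    projFamily_univ E] with ω h1 h2 h3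
  rw [h, h1, h2, h3]

variable [CompleteSpace H]

theorem star_simpleOp (E : RandomSpectralMeasure Γ P H) (s : SimpleFunc Γ ℂ) :
    ∀ᵐ ω ∂P, simpleOp E (s.map star) ω = star (simpleOp E s ω) := by
  have h : ∀ᵐ ω ∂P, ∀ z ∈ s.range,
      star (projFamily E (s ⁻¹' {z}) ω) = projFamily E (s ⁻¹' {z}) ω :=
    (Finset.eventually_all _).2 fun z _ => star_projFamily E (s.measurableSet_fiber z)
  filter_upwards [simpleOp_map E s star, h] with ω h1 h2
  rw [h1, simpleOp, star_sum]
  exact Finset.sum_congr rfl fun c hc => by rw [star_smul, h2 c hc]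

/-- With $t=\sqrt{C^2-|s|^2}$, again simple, $\bar s s+\bar t t=C^2$. The calculus turns this into
$\|I(s)x\|^2+\|I(t)x\|^2=C^2\|x\|^2$. -/
theorem norm_simpleOp_le (E : RandomSpectralMeasure Γ P H) (s : SimpleFunc Γ ℂ) {C : ℝ}
    (hC : 0 ≤ C) (hs : ∀ γ, ‖s γ‖ ≤ C) : ∀ᵐ ω ∂P, ‖simpleOp E s ω‖ ≤ C := by
  set t : SimpleFunc Γ ℂ := s.map fun z => (Real.sqrt (C ^ 2 - ‖z‖ ^ 2) : ℂ) with ht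
  have hst : s.map star * s + t.map star * t = SimpleFunc.const Γ ((C : ℂ) ^ 2) := by
    ext γ
    have h1 : 0 ≤ C ^ 2 - ‖s γ‖ ^ 2 := by
      have := hs γ
      nlinarith [norm_nonneg (s γ)]
    simp only [SimpleFunc.coe_add, SimpleFunc.coe_mul, SimpleFunc.coe_map, Pi.add_apply,
      Pi.mul_apply, Function.comp_apply, SimpleFunc.coe_const, Function.const_apply, ht]
    rw [Complex.star_def, Complex.conj_ofReal, ← Complex.ofReal_mul,
      Real.mul_self_sqrt h1, Complex.conj_mul']
    push_cast
    ring
  filter_upwards [simpleOp_add E (s.map star * s) (t.map star * t), simpleOp_mul E (s.map star) s,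
    simpleOp_mul E (t.map star) t, star_simpleOp E s, star_simpleOp E t,
    simpleOp_const E ((C : ℂ) ^ 2)] with ω h1 h2 h3 h4 h5 h6
  rw [hst, h6, h2, h3, h4, h5] at h1
  refine ContinuousLinearMap.opNorm_le_bound _ hC fun x => ?_
  have h7 := congrArg (fun A : H →L[ℂ] H => (inner ℂ (A x) x).re) h1
  simp only [ContinuousLinearMap.star_eq_adjoint, add_apply, mul_apply_eq_comp, inner_add_left,
    ContinuousLinearMap.adjoint_inner_left, Complex.add_re, smul_apply, one_apply_eq_self,
    inner_smul_left] at h7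
  rw [inner_self_eq_norm_sq_to_K, inner_self_eq_norm_sq_to_K, inner_self_eq_norm_sq_to_K] at h7
  have h8 : C ^ 2 * ‖x‖ ^ 2 = ‖simpleOp E s ω x‖ ^ 2 + ‖simpleOp E t ω x‖ ^ 2 := by
    simpa [← Complex.ofReal_pow, ← Complex.ofReal_mul] using h7
  refine le_of_sq_le_sq ?_ (by positivity)
  nlinarith [sq_nonneg ‖simpleOp E t ω x‖]

end SimpleOperators

/-! ### Calculus for bounded measurable functions. -/

section Bounded

variable {Γ : Type*} [MeasurableSpace Γ]

/-- Bounded measurable functions. -/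
structure IsBddMeasurable (u : Γ → ℂ) : Prop where
  measurable : Measurable u
  bounded : ∃ C : ℝ, ∀ γ, ‖u γ‖ ≤ C

theorem IsBddMeasurable.exists_nonneg {u : Γ → ℂ} (hu : IsBddMeasurable u) :
    ∃ C : ℝ, 0 ≤ C ∧ ∀ γ, ‖u γ‖ ≤ C := by
  obtain ⟨C, hC⟩ := hu.bounded
  exact ⟨|C|, abs_nonneg C, fun γ => (hC γ).trans (le_abs_self C)⟩

theorem IsBddMeasurable.add {u v : Γ → ℂ} (hu : IsBddMeasurable u) (hv : IsBddMeasurable v) :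
    IsBddMeasurable fun γ => u γ + v γ := by
  obtain ⟨C, hC⟩ := hu.bounded
  obtain ⟨D, hD⟩ := hv.bounded
  exact ⟨hu.measurable.add hv.measurable, C + D, fun γ =>
    (norm_add_le _ _).trans (add_le_add (hC γ) (hD γ))⟩

theorem IsBddMeasurable.mul {u v : Γ → ℂ} (hu : IsBddMeasurable u) (hv : IsBddMeasurable v) :
    IsBddMeasurable fun γ => u γ * v γ := by
  obtain ⟨C, hC0, hC⟩ := hu.exists_nonneg
  obtain ⟨D, hD⟩ := hv.bounded
  exact ⟨hu.measurable.mul hv.measurable, C * D, fun γ => by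
    rw [norm_mul]
    exact mul_le_mul (hC γ) (hD γ) (norm_nonneg _) hC0⟩

theorem IsBddMeasurable.star {u : Γ → ℂ} (hu : IsBddMeasurable u) :
    IsBddMeasurable fun γ => star (u γ) := by
  obtain ⟨C, hC⟩ := hu.bounded
  exact ⟨Complex.continuous_conj.measurable.comp hu.measurable, C, fun γ => by rw [norm_star]; exact hC γ⟩

theorem IsBddMeasurable.indicator {u : Γ → ℂ} (hu : IsBddMeasurable u) {σ : Set Γ}
    (hσ : MeasurableSet σ) : IsBddMeasurable (σ.indicator u) := by
  obtain ⟨C, hC⟩ := hu.bounded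
  exact ⟨hu.measurable.indicator hσ, C, fun γ => (norm_indicator_le_norm_self u γ).trans (hC γ)⟩

theorem isBddMeasurable_const (c : ℂ) : IsBddMeasurable fun _ : Γ => c :=
  ⟨measurable_const, ‖c‖, fun _ => le_rfl⟩

theorem isBddMeasurable_simpleFunc (s : SimpleFunc Γ ℂ) : IsBddMeasurable s :=
  ⟨s.measurable, (s.map norm).exists_forall_le⟩

/-- The values lie in a compact ball, so finitely many points of a dense sequence are within `ε` of
all of them. Rounding to the nearest of the first points is then uniformly accurate. -/
theorem IsBddMeasurable.exists_simpleFunc_tendstoUniformly {u : Γ → ℂ} (hu : IsBddMeasurable u) :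
    ∃ s : ℕ → SimpleFunc Γ ℂ, TendstoUniformly (fun k γ => s k γ) u atTop := by
  obtain ⟨C, hC⟩ := hu.bounded
  let e := TopologicalSpace.denseSeq ℂ
  refine ⟨fun N => (SimpleFunc.nearestPt e N).comp u hu.measurable, ?_⟩
  rw [EMetric.tendstoUniformly_iff]
  intro ε hε
  have hcov : Metric.closedBall (0 : ℂ) C ⊆ ⋃ k, Metric.eball (e k) ε := by
    intro z _
    obtain ⟨k, hk⟩ := (TopologicalSpace.denseRange_denseSeq ℂ).exists_mem_open
      Metric.isOpen_eball ⟨z, Metric.mem_eball_self hε⟩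
    exact Set.mem_iUnion.2 ⟨k, Metric.mem_eball_comm.1 hk⟩
  obtain ⟨t, ht⟩ := (isCompact_closedBall (0 : ℂ) C).elim_finite_subcover _
    (fun _ => Metric.isOpen_eball) hcov
  filter_upwards [eventually_ge_atTop (t.sup id)] with N hN γ
  have hγ : u γ ∈ Metric.closedBall (0 : ℂ) C := by simpa using hC γ
  obtain ⟨k, hk, hkγ⟩ := Set.mem_iUnion₂.1 (ht hγ)
  rw [edist_comm]
  refine (SimpleFunc.edist_nearestPt_le e (u γ) ((Finset.le_sup (f := id) hk).trans hN)).trans_lt ?_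
  rw [edist_comm]
  exact hkγ

theorem tendstoUniformly_mul {u v : Γ → ℂ} (hu : IsBddMeasurable u) (hv : IsBddMeasurable v)
    {s t : ℕ → Γ → ℂ} (hs : TendstoUniformly s u atTop) (ht : TendstoUniformly t v atTop) :
    TendstoUniformly (fun k γ => s k γ * t k γ) (fun γ => u γ * v γ) atTop := by
  obtain ⟨C, hC0, hC⟩ := hu.exists_nonneg
  obtain ⟨D, hD0, hD⟩ := hv.exists_nonneg
  rw [Metric.tendstoUniformly_iff] at *
  intro ε hε
  -- The errors contribute at most $\delta D+C\delta+\delta^2$; the bound $\delta\le 1$ makes the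
  -- quadratic term linear.
  have hδ : 0 < min 1 (ε / (C + D + 2)) := by positivity
  filter_upwards [hs _ hδ, ht _ hδ] with k h1 h2 γ
  have h3 := h1 γ
  have h4 := h2 γ
  rw [dist_eq_norm] at *
  have h5 : u γ * v γ - s k γ * t k γ
      = (u γ - s k γ) * v γ + u γ * (v γ - t k γ) - (u γ - s k γ) * (v γ - t k γ) := by ring
  rw [h5]
  have h6 : min 1 (ε / (C + D + 2)) * (C + D + 2) ≤ ε := by
    calc _ ≤ ε / (C + D + 2) * (C + D + 2) := by gcongr; exact min_le_right _ _
      _ = ε := by field_simp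
  set δ := min 1 (ε / (C + D + 2))
  have hδ1 : δ ≤ 1 := min_le_left _ _
  calc _ ≤ ‖u γ - s k γ‖ * ‖v γ‖ + ‖u γ‖ * ‖v γ - t k γ‖ + ‖u γ - s k γ‖ * ‖v γ - t k γ‖ := by
        refine (norm_sub_le _ _).trans (add_le_add ((norm_add_le _ _).trans ?_) ?_)
        · rw [norm_mul, norm_mul]
        · rw [norm_mul]
    _ ≤ δ * D + C * δ + δ * 1 := by
        gcongr
        · exact hD γ
        · exact hC γ
        · exact h4.le.trans hδ1
    _ < δ * (C + D + 2) := by nlinarith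
    _ ≤ ε := h6

variable {Ω : Type*} [MeasurableSpace Ω] {P : Measure Ω}
  {H : Type*} [NormedAddCommGroup H] [InnerProductSpace ℂ H]

open Classical in
/-- The operators `∫ u dE(ω)`, as limits for the operator norm. -/
def bddOp (E : RandomSpectralMeasure Γ P H) (u : Γ → ℂ) (ω : Ω) : H →L[ℂ] H :=
  if h : ∃ s : ℕ → SimpleFunc Γ ℂ, TendstoUniformly (fun k γ => s k γ) u atTop then
    limUnder atTop fun k => simpleOp E (h.choose k) ω
  else 0

variable [TopologicalSpace.SeparableSpace H] [CompleteSpace H]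

/-- Restricting the tolerances to $1/(m+1)$ leaves countably many conditions, so a single null set
serves for all of them and uniform convergence passes to the operators. -/
theorem norm_simpleOp_sub_le_of_forall (E : RandomSpectralMeasure Γ P H)
    (s t : ℕ → SimpleFunc Γ ℂ) : ∀ᵐ ω ∂P, ∀ j k m : ℕ,
      (∀ γ, ‖s j γ - t k γ‖ ≤ 1 / ((m : ℝ) + 1)) →
        ‖simpleOp E (s j) ω - simpleOp E (t k) ω‖ ≤ 1 / ((m : ℝ) + 1) := by
  simp only [ae_all_iff, eventually_imp_distrib_left]
  intro j k m h
  have hst : s j - t k = s j + (-1 : ℂ) • t k := by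
    ext γ; simp [sub_eq_add_neg]
  filter_upwards [norm_simpleOp_le E (s j - t k) (by positivity) h,
    simpleOp_add E (s j) ((-1 : ℂ) • t k), simpleOp_smul E (-1) (t k)] with ω h1 h2 h3
  rwa [hst, h2, h3, neg_one_smul, ← sub_eq_add_neg] at h1

theorem cauchySeq_simpleOp (E : RandomSpectralMeasure Γ P H) {u : Γ → ℂ}
    {s : ℕ → SimpleFunc Γ ℂ} (hs : TendstoUniformly (fun k γ => s k γ) u atTop) :
    ∀ᵐ ω ∂P, CauchySeq fun k => simpleOp E (s k) ω := by
  filter_upwards [norm_simpleOp_sub_le_of_forall E s s] with ω hω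
  rw [Metric.cauchySeq_iff']
  intro ε hε
  obtain ⟨m, hm⟩ := exists_nat_one_div_lt hε
  obtain ⟨N, hN⟩ := eventually_atTop.1
    (Metric.tendstoUniformly_iff.1 hs (1 / ((m : ℝ) + 1) / 2) (by positivity))
  refine ⟨N, fun n hn => ?_⟩
  rw [dist_eq_norm]
  refine (hω n N m fun γ => ?_).trans_lt hm
  have h1 := hN n hn γ
  have h2 := hN N le_rfl γ
  rw [← dist_eq_norm]
  linarith [dist_triangle_left (s n γ) (s N γ) (u γ)]

theorem tendsto_simpleOp_sub (E : RandomSpectralMeasure Γ P H) {u : Γ → ℂ}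
    {s t : ℕ → SimpleFunc Γ ℂ} (hs : TendstoUniformly (fun k γ => s k γ) u atTop)
    (ht : TendstoUniformly (fun k γ => t k γ) u atTop) :
    ∀ᵐ ω ∂P, Tendsto (fun k => simpleOp E (s k) ω - simpleOp E (t k) ω) atTop (𝓝 0) := by
  filter_upwards [norm_simpleOp_sub_le_of_forall E s t] with ω hω
  rw [Metric.tendsto_nhds]
  intro ε hε
  obtain ⟨m, hm⟩ := exists_nat_one_div_lt hε
  filter_upwards [Metric.tendstoUniformly_iff.1 hs (1 / ((m : ℝ) + 1) / 2) (by positivity),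
    Metric.tendstoUniformly_iff.1 ht (1 / ((m : ℝ) + 1) / 2) (by positivity)] with n h1 h2
  rw [dist_zero_right]
  refine (hω n n m fun γ => ?_).trans_lt hm
  rw [← dist_eq_norm]
  linarith [dist_triangle_left (s n γ) (t n γ) (u γ), h1 γ, h2 γ]

/-- The operator is defined through one chosen sequence. Any other uniform approximation has, a.e.,
the same limit, because the difference of the two tends to zero in norm. -/
theorem tendsto_bddOp (E : RandomSpectralMeasure Γ P H) {u : Γ → ℂ}
    {s : ℕ → SimpleFunc Γ ℂ} (hs : TendstoUniformly (fun k γ => s k γ) u atTop) :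
    ∀ᵐ ω ∂P, Tendsto (fun k => simpleOp E (s k) ω) atTop (𝓝 (bddOp E u ω)) := by
  have h : ∃ s : ℕ → SimpleFunc Γ ℂ, TendstoUniformly (fun k γ => s k γ) u atTop := ⟨s, hs⟩
  filter_upwards [cauchySeq_simpleOp E h.choose_spec, tendsto_simpleOp_sub E hs h.choose_spec]
    with ω h1 h2
  rw [bddOp, dif_pos h]
  simpa using h2.add h1.tendsto_limUnder

theorem bddOp_simpleFunc (E : RandomSpectralMeasure Γ P H) (s : SimpleFunc Γ ℂ) :
    ∀ᵐ ω ∂P, bddOp E s ω = simpleOp E s ω := by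
  have h : TendstoUniformly (fun (_ : ℕ) γ => s γ) s atTop := by
    rw [Metric.tendstoUniformly_iff]
    exact fun ε hε => Eventually.of_forall fun _ γ => by simpa using hε
  filter_upwards [tendsto_bddOp E (s := fun _ => s) h] with ω hω
  exact tendsto_nhds_unique hω tendsto_const_nhds

theorem bddOp_add (E : RandomSpectralMeasure Γ P H) {u v : Γ → ℂ} (hu : IsBddMeasurable u)
    (hv : IsBddMeasurable v) :
    ∀ᵐ ω ∂P, bddOp E (fun γ => u γ + v γ) ω = bddOp E u ω + bddOp E v ω := by
  obtain ⟨s, hs⟩ := hu.exists_simpleFunc_tendstoUniformly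
  obtain ⟨t, ht⟩ := hv.exists_simpleFunc_tendstoUniformly
  filter_upwards [tendsto_bddOp E hs, tendsto_bddOp E ht,
    tendsto_bddOp E (s := fun k => s k + t k) (hs.add ht),
    ae_all_iff.2 fun k => simpleOp_add E (s k) (t k)] with ω h1 h2 h3 h4
  simp only [h4] at h3
  exact tendsto_nhds_unique h3 (h1.add h2)

theorem bddOp_mul (E : RandomSpectralMeasure Γ P H) {u v : Γ → ℂ} (hu : IsBddMeasurable u)
    (hv : IsBddMeasurable v) :
    ∀ᵐ ω ∂P, bddOp E (fun γ => u γ * v γ) ω = bddOp E u ω * bddOp E v ω := by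
  obtain ⟨s, hs⟩ := hu.exists_simpleFunc_tendstoUniformly
  obtain ⟨t, ht⟩ := hv.exists_simpleFunc_tendstoUniformly
  filter_upwards [tendsto_bddOp E hs, tendsto_bddOp E ht,
    tendsto_bddOp E (s := fun k => s k * t k) (tendstoUniformly_mul hu hv hs ht),
    ae_all_iff.2 fun k => simpleOp_mul E (s k) (t k)] with ω h1 h2 h3 h4
  simp only [h4] at h3
  exact tendsto_nhds_unique h3 (h1.mul h2)

theorem bddOp_star (E : RandomSpectralMeasure Γ P H) {u : Γ → ℂ} (hu : IsBddMeasurable u) :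
    ∀ᵐ ω ∂P, bddOp E (fun γ => star (u γ)) ω = star (bddOp E u ω) := by
  obtain ⟨s, hs⟩ := hu.exists_simpleFunc_tendstoUniformly
  have hs' : TendstoUniformly (fun k γ => (s k).map star γ) (fun γ => star (u γ)) atTop := by
    rw [Metric.tendstoUniformly_iff] at hs ⊢
    simpa [dist_eq_norm, ← map_sub, RCLike.norm_conj] using hs
  filter_upwards [tendsto_bddOp E hs, tendsto_bddOp E hs',
    ae_all_iff.2 fun k => star_simpleOp E (s k)] with ω h1 h2 h3
  simp only [h3] at h2
  exact tendsto_nhds_unique h2 h1.star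

theorem bddOp_indicator_one (E : RandomSpectralMeasure Γ P H) {σ : Set Γ}
    (hσ : MeasurableSet σ) :
    ∀ᵐ ω ∂P, bddOp E (σ.indicator fun _ => 1) ω = projFamily E σ ω := by
  have h : σ.indicator (fun _ => (1 : ℂ)) =
      SimpleFunc.piecewise σ hσ (SimpleFunc.const Γ 1) (SimpleFunc.const Γ 0) := by
    ext γ
    by_cases hγ : γ ∈ σ <;> simp [hγ]
  filter_upwards [bddOp_simpleFunc E
    (SimpleFunc.piecewise σ hσ (SimpleFunc.const Γ 1) (SimpleFunc.const Γ 0)),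
    simpleOp_indicator E hσ] with ω h1 h2
  rw [h, h1, h2]

theorem bddOp_indicator (E : RandomSpectralMeasure Γ P H) {u : Γ → ℂ} (hu : IsBddMeasurable u)
    {σ : Set Γ} (hσ : MeasurableSet σ) :
    ∀ᵐ ω ∂P, bddOp E (σ.indicator u) ω = projFamily E σ ω * bddOp E u ω := by
  have h : σ.indicator u = fun γ => σ.indicator (fun _ => (1 : ℂ)) γ * u γ := by
    ext γ
    by_cases hγ : γ ∈ σ <;> simp [hγ]
  filter_upwards [bddOp_mul E ((isBddMeasurable_const 1).indicator hσ) hu,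
    bddOp_indicator_one E hσ] with ω h1 h2
  rw [h, h1, h2]

theorem bddOp_indicator' (E : RandomSpectralMeasure Γ P H) {u : Γ → ℂ} (hu : IsBddMeasurable u)
    {σ : Set Γ} (hσ : MeasurableSet σ) :
    ∀ᵐ ω ∂P, bddOp E (σ.indicator u) ω = bddOp E u ω * projFamily E σ ω := by
  have h : σ.indicator u = fun γ => u γ * σ.indicator (fun _ => (1 : ℂ)) γ := by
    ext γ
    by_cases hγ : γ ∈ σ <;> simp [hγ]
  filter_upwards [bddOp_mul E hu ((isBddMeasurable_const 1).indicator hσ),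
    bddOp_indicator_one E hσ] with ω h1 h2
  rw [h, h1, h2]

/-- Since $|u|^2=\bar u u$, its operator is $I(u)^*I(u)$. The null set does not depend on `x`, so a
random vector may be inserted. -/
theorem inner_bddOp_norm_sq (E : RandomSpectralMeasure Γ P H) {u : Γ → ℂ}
    (hu : IsBddMeasurable u) : ∀ᵐ ω ∂P, ∀ x,
      (inner ℂ x (bddOp E (fun γ => ((‖u γ‖ ^ 2 : ℝ) : ℂ)) ω x)).re = ‖bddOp E u ω x‖ ^ 2 := by
  have h : (fun γ => ((‖u γ‖ ^ 2 : ℝ) : ℂ)) = fun γ => star (u γ) * u γ := by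
    ext γ
    rw [Complex.star_def, Complex.conj_mul', Complex.ofReal_pow]
  filter_upwards [bddOp_mul E hu.star hu, bddOp_star E hu] with ω h1 h2 x
  rw [h, h1, h2, mul_apply_eq_comp, ContinuousLinearMap.star_eq_adjoint,
    ContinuousLinearMap.adjoint_inner_right, inner_self_eq_norm_sq_to_K]
  norm_cast

/-- Writing $v-u=|w|^2$ with $w=\sqrt{v-u}$, the difference of the quadratic forms is $\|I(w)x\|^2$.
-/
theorem inner_bddOp_mono (E : RandomSpectralMeasure Γ P H) {u v : Γ → ℝ}
    (hu : IsBddMeasurable fun γ => (u γ : ℂ)) (hv : IsBddMeasurable fun γ => (v γ : ℂ))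
    (huv : ∀ γ, u γ ≤ v γ) : ∀ᵐ ω ∂P, ∀ x,
      (inner ℂ x (bddOp E (fun γ => (u γ : ℂ)) ω x)).re
        ≤ (inner ℂ x (bddOp E (fun γ => (v γ : ℂ)) ω x)).re := by
  set w : Γ → ℂ := fun γ => ((Real.sqrt (v γ - u γ) : ℝ) : ℂ) with hw
  have hwm : IsBddMeasurable w := by
    have hum : Measurable u := Complex.measurable_re.comp hu.measurable
    have hvm : Measurable v := Complex.measurable_re.comp hv.measurable
    refine ⟨Complex.measurable_ofReal.comp (hvm.sub hum).sqrt, ?_⟩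
    obtain ⟨C, hC⟩ := hu.bounded
    obtain ⟨D, hD⟩ := hv.bounded
    refine ⟨Real.sqrt (C + D), fun γ => ?_⟩
    rw [hw, Complex.norm_real, Real.norm_eq_abs, abs_of_nonneg (Real.sqrt_nonneg _)]
    refine Real.sqrt_le_sqrt ?_
    have h1 := hC γ
    have h2 := hD γ
    simp only [Complex.norm_real, Real.norm_eq_abs] at h1 h2
    linarith [neg_abs_le (u γ), le_abs_self (v γ)]
  have hvu : (fun γ => (v γ : ℂ)) = fun γ => (u γ : ℂ) + ((‖w γ‖ ^ 2 : ℝ) : ℂ) := by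
    ext γ
    rw [hw, Complex.norm_real, Real.norm_eq_abs, sq_abs, Real.sq_sqrt (by linarith [huv γ])]
    push_cast
    ring
  have hww : IsBddMeasurable fun γ => ((‖w γ‖ ^ 2 : ℝ) : ℂ) := by
    have : (fun γ => ((‖w γ‖ ^ 2 : ℝ) : ℂ)) = fun γ => star (w γ) * w γ := by
      ext γ
      rw [Complex.star_def, Complex.conj_mul', Complex.ofReal_pow]
    rw [this]
    exact hwm.star.mul hwm
  filter_upwards [bddOp_add E hu hww, inner_bddOp_norm_sq E hwm] with ω h1 h2 x
  rw [hvu, h1, add_apply, inner_add_right, Complex.add_re, h2]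
  linarith [sq_nonneg ‖bddOp E w ω x‖]

end Bounded

/-! ### Existence of the bounded integrals on $H$ and on random vectors. -/

section Existence

variable {Γ : Type*} [MeasurableSpace Γ] {Ω : Type*} [MeasurableSpace Ω] {P : Measure Ω}
  {H : Type*} [NormedAddCommGroup H] [InnerProductSpace ℂ H]

/-- The map `H → L⁰(P, H)` given by a measurable family of bounded operators. -/
def ofFamily (a : Ω → H →L[ℂ] H) (ha : ∀ x, AEStronglyMeasurable (fun ω => a ω x) P) :
    H →ₗ[ℂ] (Ω →ₘ[P] H) where
  toFun x := AEEqFun.mk (fun ω => a ω x) (ha x)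
  map_add' x y := by
    rw [AEEqFun.mk_add_mk, AEEqFun.mk_eq_mk]
    exact Eventually.of_forall fun ω => map_add (a ω) x y
  map_smul' c x := by
    rw [RingHom.id_apply, AEEqFun.smul_mk, AEEqFun.mk_eq_mk]
    exact Eventually.of_forall fun ω => map_smul (a ω) c x

theorem isDecomposedBy_ofFamily (a : Ω → H →L[ℂ] H)
    (ha : ∀ x, AEStronglyMeasurable (fun ω => a ω x) P) : IsDecomposedBy (ofFamily a ha) a :=
  fun x => AEEqFun.coeFn_mk _ (ha x)

theorem pointwiseApply_apply_ae (A : H →ₗ[ℂ] (Ω →ₘ[P] H)) (a : Ω → H →L[ℂ] H)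
    (h : IsDecomposedBy A a) (g : Ω →ₘ[P] H) :
    ∀ᵐ ω ∂P, pointwiseApply A a h g ω = a ω (g ω) :=
  AEEqFun.coeFn_mk _ _

theorem isBoundedIntegral_integral {V : Type*} [AddCommGroup V] [Module ℂ V]
    {F : Set Γ → V →ₗ[ℂ] (Ω →ₘ[P] H)} {u : Γ → ℂ} {A : V →ₗ[ℂ] (Ω →ₘ[P] H)}
    (h : IsBoundedIntegral F u A) : IsBoundedIntegral F u (integral F u) := by
  have h' : ∃ A, IsBoundedIntegral F u A := ⟨A, h⟩
  rw [integral, dif_pos h']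
  exact h'.choose_spec

variable [TopologicalSpace.SeparableSpace H] [CompleteSpace H]

theorem aestronglyMeasurable_bddOp (E : RandomSpectralMeasure Γ P H) {u : Γ → ℂ}
    (hu : IsBddMeasurable u) (x : H) : AEStronglyMeasurable (fun ω => bddOp E u ω x) P := by
  obtain ⟨s, hs⟩ := hu.exists_simpleFunc_tendstoUniformly
  refine aestronglyMeasurable_of_tendsto_ae atTop
    (f := fun k ω => simpleIntegral E.toFun (s k) x ω)
    (fun k => (simpleIntegral E.toFun (s k) x).aestronglyMeasurable) ?_
  filter_upwards [tendsto_bddOp E hs, ae_all_iff.2 fun k => simpleIntegral_toFun E (s k) x]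
    with ω h1 h2
  simp only [h2]
  exact ((ContinuousLinearMap.apply ℂ H x).continuous.tendsto _).comp h1

theorem isBoundedIntegral_toFun (E : RandomSpectralMeasure Γ P H) {u : Γ → ℂ}
    (hu : IsBddMeasurable u) : IsBoundedIntegral E.toFun u (integral E.toFun u) := by
  refine isBoundedIntegral_integral
    (A := ofFamily (bddOp E u) (aestronglyMeasurable_bddOp E hu)) fun s hs x => ?_
  filter_upwards [tendsto_bddOp E hs, ae_all_iff.2 fun k => simpleIntegral_toFun E (s k) x,
    isDecomposedBy_ofFamily (bddOp E u) (aestronglyMeasurable_bddOp E hu) x] with ω h1 h2 h3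
  simp only [h2, h3]
  exact ((ContinuousLinearMap.apply ℂ H x).continuous.tendsto _).comp h1

theorem isBoundedIntegral_extFamily (E : RandomSpectralMeasure Γ P H) {u : Γ → ℂ}
    (hu : IsBddMeasurable u) : IsBoundedIntegral (extFamily E) u (integral (extFamily E) u) := by
  have hd := isDecomposedBy_ofFamily (bddOp E u) (aestronglyMeasurable_bddOp E hu)
  refine isBoundedIntegral_integral (A := pointwiseApply _ _ hd) fun s hs g => ?_
  filter_upwards [tendsto_bddOp E hs, ae_all_iff.2 fun k => simpleIntegral_extFamily E (s k) g,
    pointwiseApply_apply_ae _ _ hd g] with ω h1 h2 h3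
  simp only [h2, h3]
  exact ((ContinuousLinearMap.apply ℂ H (g ω)).continuous.tendsto _).comp h1

theorem integral_toFun_apply_ae (E : RandomSpectralMeasure Γ P H) {u : Γ → ℂ}
    (hu : IsBddMeasurable u) (x : H) :
    ∀ᵐ ω ∂P, integral E.toFun u x ω = bddOp E u ω x := by
  obtain ⟨s, hs⟩ := hu.exists_simpleFunc_tendstoUniformly
  filter_upwards [tendsto_bddOp E hs, ae_all_iff.2 fun k => simpleIntegral_toFun E (s k) x,
    isBoundedIntegral_toFun E hu s hs x] with ω h1 h2 h3
  simp only [h2] at h3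
  exact tendsto_nhds_unique h3
    (((ContinuousLinearMap.apply ℂ H x).continuous.tendsto _).comp h1)

theorem integral_extFamily_apply_ae (E : RandomSpectralMeasure Γ P H) {u : Γ → ℂ}
    (hu : IsBddMeasurable u) (g : Ω →ₘ[P] H) :
    ∀ᵐ ω ∂P, integral (extFamily E) u g ω = bddOp E u ω (g ω) := by
  obtain ⟨s, hs⟩ := hu.exists_simpleFunc_tendstoUniformly
  filter_upwards [tendsto_bddOp E hs, ae_all_iff.2 fun k => simpleIntegral_extFamily E (s k) g,
    isBoundedIntegral_extFamily E hu s hs g] with ω h1 h2 h3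
  simp only [h2] at h3
  exact tendsto_nhds_unique h3
    (((ContinuousLinearMap.apply ℂ H (g ω)).continuous.tendsto _).comp h1)

theorem integral_extFamily_constMap (E : RandomSpectralMeasure Γ P H) {u : Γ → ℂ}
    (hu : IsBddMeasurable u) (x : H) :
    integral (extFamily E) u (constMap P H x) = integral E.toFun u x := by
  refine AEEqFun.ext ?_
  filter_upwards [integral_extFamily_apply_ae E hu (constMap P H x),
    integral_toFun_apply_ae E hu x, constMap_apply_ae P x] with ω h1 h2 h3
  rw [h1, h2, h3]

end Existence

/-! ### Measurability of truncations and uniform approximation of $|f|^2$. -/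

section Truncation

theorem absInfty_sq_eq {Γ : Type*} {f : Γ → OnePoint ℂ} {σ : Set Γ} {C : ℝ≥0}
    (hC : ∀ γ ∈ σ, absInfty (f γ) ≤ C) {γ : Γ} (hγ : γ ∈ σ) :
    absInfty (f γ) ^ 2 = ENNReal.ofReal (‖trunc f σ γ‖ ^ 2) := by
  have h1 := hC γ hγ
  rw [trunc, Set.indicator_of_mem hγ]
  generalize f γ = z at h1
  induction z using OnePoint.rec with
  | infty => simp [absInfty] at h1
  | coe z =>
    simp only [absInfty, OnePoint.elim_some, id]
    rw [ENNReal.ofReal_pow (norm_nonneg _), ofReal_norm]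

variable {Γ : Type*} [MeasurableSpace Γ]

/-- The plane is openly embedded and $\{\infty\}$ is measurable, so a preimage is the image of a
Borel set of the plane, possibly together with $\infty$. -/
theorem measurable_onePoint {β : Type*} [MeasurableSpace β] (φ : OnePoint ℂ → β)
    (h : Measurable fun z : ℂ => φ z) : @Measurable _ _ (borel (OnePoint ℂ)) _ φ := by
  let _ : MeasurableSpace (OnePoint ℂ) := borel (OnePoint ℂ)
  have : BorelSpace (OnePoint ℂ) := ⟨rfl⟩
  have he : MeasurableEmbedding ((↑) : ℂ → OnePoint ℂ) :=
    OnePoint.isOpenEmbedding_coe.measurableEmbedding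
  intro S hS
  have hm := he.measurableSet_image.2 (h hS)
  by_cases hi : φ OnePoint.infty ∈ S
  · have : φ ⁻¹' S = (↑) '' ((fun z : ℂ => φ z) ⁻¹' S) ∪ {OnePoint.infty} := by
      ext z
      induction z using OnePoint.rec <;> simp [hi]
    rw [this]
    exact hm.union (measurableSet_singleton _)
  · have : φ ⁻¹' S = (↑) '' ((fun z : ℂ => φ z) ⁻¹' S) := by
      ext z
      induction z using OnePoint.rec <;> simp [hi]
    rw [this]
    exact hm

theorem measurable_absInfty_comp {f : Γ → OnePoint ℂ}
    (hf : @Measurable Γ (OnePoint ℂ) _ (borel (OnePoint ℂ)) f) :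
    Measurable fun γ => absInfty (f γ) :=
  @Measurable.comp _ _ _ _ (borel (OnePoint ℂ)) _ _ _
    (measurable_onePoint absInfty measurable_enorm) hf

theorem isBddMeasurable_trunc {f : Γ → OnePoint ℂ}
    (hf : @Measurable Γ (OnePoint ℂ) _ (borel (OnePoint ℂ)) f) {σ : Set Γ}
    (hσ : MeasurableSet σ) {C : ℝ≥0} (hC : ∀ γ ∈ σ, absInfty (f γ) ≤ C) :
    IsBddMeasurable (trunc f σ) := by
  have h : Measurable fun γ => (f γ).elim (0 : ℂ) id :=
    @Measurable.comp _ _ _ _ (borel (OnePoint ℂ)) _ _ _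
      (measurable_onePoint (fun z => z.elim (0 : ℂ) id) measurable_id) hf
  refine ⟨h.indicator hσ, C, fun γ => ?_⟩
  by_cases hγ : γ ∈ σ
  · have h1 := hC γ hγ
    rw [trunc, Set.indicator_of_mem hγ]
    generalize f γ = z at h1
    induction z using OnePoint.rec with
    | infty => simp
    | coe z =>
      simp only [absInfty, OnePoint.elim_some, id] at h1 ⊢
      rw [enorm_eq_nnnorm, ENNReal.coe_le_coe] at h1
      exact_mod_cast h1
  · simp [trunc, hγ]

theorem eapprox_le {u : Γ → ℝ≥0∞} (hu : Measurable u) (n : ℕ) (γ : Γ) :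
    SimpleFunc.eapprox u n γ ≤ u γ :=
  (le_iSup (fun n => SimpleFunc.eapprox u n γ) n).trans_eq (SimpleFunc.iSup_eapprox_apply hu γ)

/-- The `n`-th approximant is the largest of the first `n` enumerated rationals not exceeding `u`.
Once the finitely many grid points $j/(m+1)$ up to `C` have been enumerated, its error is below the
mesh wherever `u ≤ C`. -/
theorem exists_forall_le_eapprox_add {u : Γ → ℝ≥0∞} (hu : Measurable u) (C : ℝ≥0) {ε : ℝ}
    (hε : 0 < ε) : ∃ N, ∀ n ≥ N, ∀ γ, u γ ≤ C →
      u γ ≤ SimpleFunc.eapprox u n γ + ENNReal.ofReal ε := by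
  obtain ⟨m, hm⟩ := exists_nat_one_div_lt hε
  set J := ⌊(C : ℝ) * (m + 1)⌋₊
  let idx : ℕ → ℕ := fun j => Encodable.encode ((j : ℚ) / (m + 1))
  -- The extra 1 is needed because the `n`-th approximant only sees rationals of index strictly
  -- below `n`.
  refine ⟨(Finset.range (J + 1)).sup idx + 1, fun n hn γ hγ => ?_⟩
  obtain ⟨r, hr⟩ : ∃ r : ℝ≥0, (r : ℝ≥0∞) = u γ :=
    ⟨_, ENNReal.coe_toNNReal (hγ.trans_lt ENNReal.coe_lt_top).ne⟩
  rw [← hr, ENNReal.coe_le_coe] at hγ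
  set j := ⌊(r : ℝ) * (m + 1)⌋₊ with hj
  have hm0 : (0 : ℝ) < m + 1 := by positivity
  have hjJ : j ≤ J := Nat.floor_le_floor (by gcongr)
  have hjn : idx j ∈ Finset.range n := Finset.mem_range.2
    (lt_of_le_of_lt (Finset.le_sup (Finset.mem_range.2 (Nat.lt_succ_of_le hjJ))) hn)
  have hrat : SimpleFunc.ennrealRatEmbed (idx j) = ENNReal.ofReal ((j : ℝ) / (m + 1)) := by
    rw [SimpleFunc.ennrealRatEmbed_encode, ENNReal.ofReal]
    push_cast
    rfl
  have hle : SimpleFunc.ennrealRatEmbed (idx j) ≤ u γ := by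
    rw [hrat, ← hr, ← ENNReal.ofReal_coe_nnreal]
    refine ENNReal.ofReal_le_ofReal ?_
    rw [div_le_iff₀ hm0]
    exact Nat.floor_le (by positivity)
  have hge : ENNReal.ofReal ((j : ℝ) / (m + 1)) ≤ SimpleFunc.eapprox u n γ := by
    rw [SimpleFunc.eapprox, SimpleFunc.approx_apply γ hu, ← hrat]
    refine le_trans (le_of_eq ?_) (Finset.le_sup hjn)
    rw [if_pos hle]
  refine le_trans ?_ (add_le_add_left hge _)
  rw [← hr, ← ENNReal.ofReal_coe_nnreal, ← ENNReal.ofReal_add (by positivity) hε.le]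
  refine ENNReal.ofReal_le_ofReal ?_
  have h1 : (r : ℝ) * (m + 1) < j + 1 := Nat.lt_floor_add_one _
  have h2 : (r : ℝ) < (j + 1) / (m + 1) := (lt_div_iff₀ hm0).2 h1
  rw [add_div] at h2
  linarith

/-- The simple functions in the definition of `randomLIntegral` for `|f|²`. -/
def normSqApprox (f : Γ → OnePoint ℂ) (n : ℕ) : SimpleFunc Γ ℂ :=
  (SimpleFunc.eapprox (fun γ => absInfty (f γ) ^ 2) n).map fun c => (c.toReal : ℂ)

/-- On a set where `f` is bounded, the simple functions defining the random integral of $|f|^2$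
converge uniformly, so the norm-limit calculus applies to them. -/
theorem tendstoUniformly_restrict_normSqApprox {f : Γ → OnePoint ℂ}
    (hf : @Measurable Γ (OnePoint ℂ) _ (borel (OnePoint ℂ)) f) {σ : Set Γ}
    (hσ : MeasurableSet σ) {C : ℝ≥0} (hC : ∀ γ ∈ σ, absInfty (f γ) ≤ C) :
    TendstoUniformly (fun n γ => (normSqApprox f n).restrict σ γ)
      (fun γ => ((‖trunc f σ γ‖ ^ 2 : ℝ) : ℂ)) atTop := by
  have hm : Measurable fun γ => absInfty (f γ) ^ 2 := (measurable_absInfty_comp hf).pow_const 2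
  rw [Metric.tendstoUniformly_iff]
  intro ε hε
  obtain ⟨N, hN⟩ := exists_forall_le_eapprox_add hm (C ^ 2) (half_pos hε)
  filter_upwards [eventually_ge_atTop N] with n hn γ
  rw [SimpleFunc.restrict_apply _ hσ]
  by_cases hγ : γ ∈ σ
  · have h1 := hN n hn γ (by push_cast; gcongr; exact hC γ hγ)
    have h2 := eapprox_le hm n γ
    have h3 := SimpleFunc.eapprox_lt_top (fun γ => absInfty (f γ) ^ 2) n γ
    rw [absInfty_sq_eq hC hγ] at h1 h2
    rw [Set.indicator_of_mem hγ, normSqApprox, SimpleFunc.map_apply]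
    generalize SimpleFunc.eapprox (fun γ => absInfty (f γ) ^ 2) n γ = q at h1 h2 h3
    lift q to ℝ≥0 using h3.ne
    rw [← ENNReal.ofReal_coe_nnreal] at h1 h2
    rw [← ENNReal.ofReal_add (by positivity) (by positivity),
      ENNReal.ofReal_le_ofReal_iff (by positivity)] at h1
    rw [ENNReal.ofReal_le_ofReal_iff (by positivity)] at h2
    rw [dist_eq_norm, ← Complex.ofReal_sub, Complex.norm_real, Real.norm_eq_abs,
      ENNReal.coe_toReal, abs_lt]
    constructor <;> linarith
  · simpa [hγ, trunc] using hε

theorem indicator_normSqApprox_le {f : Γ → OnePoint ℂ}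
    (hf : @Measurable Γ (OnePoint ℂ) _ (borel (OnePoint ℂ)) f) {σ : Set Γ} {C : ℝ≥0}
    (hC : ∀ γ ∈ σ, absInfty (f γ) ≤ C) (n : ℕ) (γ : Γ) :
    σ.indicator (fun γ => (SimpleFunc.eapprox (fun γ => absInfty (f γ) ^ 2) n γ).toReal) γ
      ≤ ‖trunc f σ γ‖ ^ 2 := by
  by_cases hγ : γ ∈ σ
  · have h2 := eapprox_le ((measurable_absInfty_comp hf).pow_const 2) n γ
    rw [absInfty_sq_eq hC hγ] at h2
    rw [Set.indicator_of_mem hγ]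
    exact ENNReal.toReal_le_of_le_ofReal (by positivity) h2
  · simp [hγ, trunc]

end Truncation

/-! ### Convergence lemmas in Hilbert space. -/

section HilbertSpace

variable {H : Type*} [NormedAddCommGroup H] [InnerProductSpace ℂ H]

theorem tendsto_of_norm_le_one {a : ℕ → H →L[ℂ] H} (ha : ∀ n, ‖a n‖ ≤ 1) {y : ℕ → H} {l : H}
    (hy : Tendsto y atTop (𝓝 l)) (hl : Tendsto (fun n => a n l) atTop (𝓝 l)) :
    Tendsto (fun n => a n (y n)) atTop (𝓝 l) := by
  have h1 : Tendsto (fun n => a n (y n - l)) atTop (𝓝 0) := by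
    refine squeeze_zero_norm (fun n => (a n).le_of_opNorm_le (ha n) _) ?_
    simpa using (tendsto_sub_nhds_zero_iff.2 hy).norm
  simpa using h1.add hl

theorem tendsto_apply_of_dense {a : ℕ → H →L[ℂ] H} (ha : ∀ n, ‖a n‖ ≤ 1) {e : ℕ → H}
    (he : DenseRange e) (h : ∀ k, Tendsto (fun n => a n (e k)) atTop (𝓝 (e k))) (y : H) :
    Tendsto (fun n => a n y) atTop (𝓝 y) := by
  rw [Metric.tendsto_nhds]
  intro ε hε
  obtain ⟨k, hk⟩ := he.exists_dist_lt y (show 0 < ε / 3 by positivity)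
  filter_upwards [Metric.tendsto_nhds.1 (h k) (ε / 3) (by positivity)] with n hn
  have h1 : dist (a n y) (a n (e k)) ≤ dist y (e k) := by
    rw [dist_eq_norm, dist_eq_norm, ← map_sub]
    simpa using (a n).le_of_opNorm_le (ha n) (y - e k)
  linarith [dist_triangle4 (a n y) (a n (e k)) (e k) y, dist_comm y (e k)]

variable [CompleteSpace H]

theorem norm_sub_sq_of_projection {p : H →L[ℂ] H} (hs : star p = p) (hi : p * p = p) (y : H) :
    ‖y - p y‖ ^ 2 = ‖y‖ ^ 2 - ‖p y‖ ^ 2 := by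
  have h1 : inner ℂ y (p y) = ((‖p y‖ ^ 2 : ℝ) : ℂ) := by
    have h2 : inner ℂ (p y) (p y) = inner ℂ y (p y) := by
      rw [← ContinuousLinearMap.adjoint_inner_right, ← ContinuousLinearMap.star_eq_adjoint, hs,
        ← mul_apply_eq_comp, hi]
    rw [← h2, inner_self_eq_norm_sq_to_K]
    norm_cast
  rw [norm_sub_sq (𝕜 := ℂ), h1, RCLike.re_eq_complex_re, Complex.ofReal_re]
  ring

/-- By Pythagoras $\|y_n-y_m\|^2=\|y_n\|^2-\|y_m\|^2$ for $m\le n$. The squared norms increase and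
are bounded, hence form a Cauchy sequence, and so do the vectors. -/
theorem exists_tendsto_of_norm_le {p : ℕ → H →L[ℂ] H} (hs : ∀ n, star (p n) = p n)
    (hi : ∀ n, p n * p n = p n) {y : ℕ → H} (hy : ∀ m n, m ≤ n → p m (y n) = y m) {C : ℝ}
    (hC : ∀ n, ‖y n‖ ≤ C) : ∃ l, Tendsto y atTop (𝓝 l) := by
  have hsq : ∀ m n, m ≤ n → ‖y n - y m‖ ^ 2 = ‖y n‖ ^ 2 - ‖y m‖ ^ 2 := fun m n hmn => by
    rw [← hy m n hmn, norm_sub_sq_of_projection (hs m) (hi m)]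
  have hmono : Monotone fun n => ‖y n‖ ^ 2 := fun m n hmn => by
    have := hsq m n hmn
    dsimp only
    nlinarith [sq_nonneg ‖y n - y m‖]
  have hbdd : BddAbove (Set.range fun n => ‖y n‖ ^ 2) :=
    ⟨C ^ 2, by rintro _ ⟨n, rfl⟩; exact pow_le_pow_left₀ (norm_nonneg _) (hC n) 2⟩
  have hcs := (tendsto_atTop_ciSup hmono hbdd).cauchySeq
  refine cauchySeq_tendsto_of_complete (Metric.cauchySeq_iff'.2 fun ε hε => ?_)
  obtain ⟨N, hN⟩ := Metric.cauchySeq_iff'.1 hcs (ε ^ 2) (by positivity)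
  refine ⟨N, fun n hn => ?_⟩
  have h1 := hN n hn
  rw [Real.dist_eq, ← hsq N n hn, abs_of_nonneg (by positivity)] at h1
  rw [dist_eq_norm]
  exact lt_of_pow_lt_pow_left₀ 2 hε.le h1

end HilbertSpace

/-! ### Bounding sequences and the square integrability criterion. -/

section Bounding

variable {Γ : Type*} [MeasurableSpace Γ] {Ω : Type*} [MeasurableSpace Ω] {P : Measure Ω}
  {H : Type*} [NormedAddCommGroup H] [InnerProductSpace ℂ H]
  {E : RandomSpectralMeasure Γ P H} {f : Γ → OnePoint ℂ} {σ τ : ℕ → Set Γ}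

theorem IsBoundingSeq.monotone (h : IsBoundingSeq E f σ) : Monotone σ :=
  monotone_nat_of_le_succ h.mono

theorem IsBoundingSeq.isBddMeasurable_trunc (h : IsBoundingSeq E f σ)
    (hf : @Measurable Γ (OnePoint ℂ) _ (borel (OnePoint ℂ)) f) (n : ℕ) :
    IsBddMeasurable (trunc f (σ n)) := by
  obtain ⟨C, hC⟩ := h.bounded n
  exact RandomOp.isBddMeasurable_trunc hf (h.measurableSet n) hC

theorem trunc_inter {Γ : Type*} (f : Γ → OnePoint ℂ) (σ τ : Set Γ) :
    trunc f (σ ∩ τ) = σ.indicator (trunc f τ) := by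
  rw [trunc, trunc, Set.indicator_indicator]

theorem memL2_toFun_iff (E : RandomSpectralMeasure Γ P H) (f : Γ → OnePoint ℂ) (x : H) :
    MemL2 (constMap P H) E.toFun f x ↔
      MemL2 LinearMap.id (extFamily E) f (constMap P H x) := by
  refine eventually_congr (Eventually.of_forall fun ω => ?_)
  simp only [randomLIntegral, extFamily_constMap E (SimpleFunc.measurableSet_fiber _ _),
    LinearMap.id_apply]

variable [TopologicalSpace.SeparableSpace H] [CompleteSpace H]

theorem norm_projFamily_le (E : RandomSpectralMeasure Γ P H) {σ : Set Γ}
    (hσ : MeasurableSet σ) : ∀ᵐ ω ∂P, ‖projFamily E σ ω‖ ≤ 1 := by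
  filter_upwards [simpleOp_indicator E hσ, norm_simpleOp_le E
    (SimpleFunc.piecewise σ hσ (SimpleFunc.const Γ 1) (SimpleFunc.const Γ 0)) zero_le_one
    fun γ => by by_cases hγ : γ ∈ σ <;> simp [hγ]] with ω h1 h2
  rwa [h1] at h2

/-- Countable additivity over the disjointed pieces gives convergence on a dense sequence; the
contraction bound extends it to every vector outside a single null set. -/
theorem IsBoundingSeq.tendsto_projFamily (h : IsBoundingSeq E f σ) :
    ∀ᵐ ω ∂P, ∀ y, Tendsto (fun n => projFamily E (σ n) ω y) atTop (𝓝 y) := by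
  have hdm : ∀ n, MeasurableSet (disjointed σ n) :=
    fun n => MeasurableSet.disjointed h.measurableSet n
  have h1 : ∀ᵐ ω ∂P, ∀ n, projFamily E (σ n) ω
      = ∑ j ∈ Finset.range (n + 1), projFamily E (disjointed σ j) ω := by
    refine ae_all_iff.2 fun n => ?_
    have h2 := projFamily_biUnion E (Finset.range (n + 1)) (disjointed σ) hdm
      (disjoint_disjointed σ)
    have h3 : ⋃ i ∈ Finset.range (n + 1), disjointed σ i = σ n := by
      have := biUnion_range_succ_disjointed σ n
      rwa [h.monotone.partialSups_eq] at this
    rwa [h3] at h2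
  have h4 : ∀ᵐ ω ∂P, ∀ k, Tendsto
      (fun n => projFamily E (σ n) ω (TopologicalSpace.denseSeq H k)) atTop
      (𝓝 (TopologicalSpace.denseSeq H k)) := by
    refine ae_all_iff.2 fun k => ?_
    have h5 := E.iUnion (disjointed σ) hdm (disjoint_disjointed σ) (TopologicalSpace.denseSeq H k)
    rw [iUnion_disjointed, h.iUnion] at h5
    filter_upwards [h5, constMap_apply_ae P (TopologicalSpace.denseSeq H k), h1,
      ae_all_iff.2 fun j => isDecomposedBy_projFamily E (hdm j) (TopologicalSpace.denseSeq H k)]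
      with ω h6 h7 h8 h9
    rw [h7] at h6
    simp only [h9] at h6
    simpa only [h8, sum_apply] using (tendsto_add_atTop_iff_nat 1).2 h6
  filter_upwards [h4, ae_all_iff.2 fun n => norm_projFamily_le E (h.measurableSet n)]
    with ω h5 h6 y
  exact tendsto_apply_of_dense h6 (TopologicalSpace.denseRange_denseSeq H) h5 y

/-- Both sides are the operator of $f\chi_{\sigma_m\cap\tau_n}$. This symmetry is what makes the
limit independent of the bounding sequence. -/
theorem projFamily_mul_bddOp_trunc
    (hf : @Measurable Γ (OnePoint ℂ) _ (borel (OnePoint ℂ)) f)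
    (hσ : IsBoundingSeq E f σ) (hτ : IsBoundingSeq E f τ) : ∀ᵐ ω ∂P, ∀ m n,
      projFamily E (σ m) ω * bddOp E (trunc f (τ n)) ω
        = projFamily E (τ n) ω * bddOp E (trunc f (σ m)) ω := by
  simp only [ae_all_iff]
  intro m n
  filter_upwards [bddOp_indicator E (hτ.isBddMeasurable_trunc hf n) (hσ.measurableSet m),
    bddOp_indicator E (hσ.isBddMeasurable_trunc hf m) (hτ.measurableSet n)] with ω h1 h2
  rw [← h1, ← h2, ← trunc_inter, ← trunc_inter, Set.inter_comm]

theorem projFamily_mul_bddOp_trunc_of_le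
    (hf : @Measurable Γ (OnePoint ℂ) _ (borel (OnePoint ℂ)) f)
    (hσ : IsBoundingSeq E f σ) : ∀ᵐ ω ∂P, ∀ m n, m ≤ n →
      projFamily E (σ m) ω * bddOp E (trunc f (σ n)) ω = bddOp E (trunc f (σ m)) ω := by
  simp only [ae_all_iff, eventually_imp_distrib_left]
  intro m n hmn
  filter_upwards [bddOp_indicator E (hσ.isBddMeasurable_trunc hf n) (hσ.measurableSet m)]
    with ω h1
  rw [← h1, ← trunc_inter, Set.inter_eq_left.2 (hσ.monotone hmn)]

theorem bddOp_trunc_mul_projFamily_of_le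
    (hf : @Measurable Γ (OnePoint ℂ) _ (borel (OnePoint ℂ)) f)
    (hσ : IsBoundingSeq E f σ) : ∀ᵐ ω ∂P, ∀ m n, m ≤ n →
      bddOp E (trunc f (σ n)) ω * projFamily E (σ m) ω = bddOp E (trunc f (σ m)) ω := by
  simp only [ae_all_iff, eventually_imp_distrib_left]
  intro m n hmn
  filter_upwards [bddOp_indicator' E (hσ.isBddMeasurable_trunc hf n) (hσ.measurableSet m)]
    with ω h1
  rw [← h1, ← trunc_inter, Set.inter_eq_left.2 (hσ.monotone hmn)]

theorem IsBoundingSeq.exists_tendsto_iff (h : IsBoundingSeq E f σ)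
    (hf : @Measurable Γ (OnePoint ℂ) _ (borel (OnePoint ℂ)) f) : ∀ᵐ ω ∂P, ∀ x,
      (∃ C : ℝ, ∀ n, ‖bddOp E (trunc f (σ n)) ω x‖ ≤ C) ↔
        ∃ l, Tendsto (fun n => bddOp E (trunc f (σ n)) ω x) atTop (𝓝 l) := by
  filter_upwards [ae_all_iff.2 fun n => star_projFamily E (h.measurableSet n),
    ae_all_iff.2 fun n => projFamily_mul_self E (h.measurableSet n),
    projFamily_mul_bddOp_trunc_of_le hf h] with ω h1 h2 h3 x
  constructor
  · rintro ⟨C, hC⟩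
    refine exists_tendsto_of_norm_le h1 h2 (fun m n hmn => ?_) hC
    rw [← h3 m n hmn, mul_apply_eq_comp]
  · rintro ⟨l, hl⟩
    obtain ⟨C, hC⟩ := hl.norm.bddAbove_range
    exact ⟨C, fun n => hC ⟨n, rfl⟩⟩

theorem sum_eapprox_eq (E : RandomSpectralMeasure Γ P H) (f : Γ → OnePoint ℂ) (g : Ω →ₘ[P] H) : ∀ᵐ ω ∂P, ∀ n,
      ∑ c ∈ (SimpleFunc.eapprox (fun γ => absInfty (f γ) ^ 2) n).range,
        c * ENNReal.ofReal (inner ℂ (g ω)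
          (extFamily E (SimpleFunc.eapprox (fun γ => absInfty (f γ) ^ 2) n ⁻¹' {c}) g ω)).re
      = ENNReal.ofReal (inner ℂ (g ω) (bddOp E (normSqApprox f n) ω (g ω))).re := by
  refine ae_all_iff.2 fun n => ?_
  set q := SimpleFunc.eapprox (fun γ => absInfty (f γ) ^ 2) n with hq
  have h1 : ∀ᵐ ω ∂P, ∀ c ∈ q.range, extFamily E (q ⁻¹' {c}) g ω
      = projFamily E (q ⁻¹' {c}) ω (g ω) :=
    (Finset.eventually_all _).2 fun c _ => extFamily_apply_ae E (q.measurableSet_fiber c) g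
  -- Nonnegativity is needed because `ENNReal.ofReal` is additive only on nonnegative terms.
  have h2 : ∀ᵐ ω ∂P, ∀ c ∈ q.range,
      0 ≤ (inner ℂ (g ω) (projFamily E (q ⁻¹' {c}) ω (g ω))).re := by
    refine (Finset.eventually_all _).2 fun c _ => ?_
    filter_upwards [star_projFamily E (q.measurableSet_fiber c),
      projFamily_mul_self E (q.measurableSet_fiber c)] with ω hs hi
    rw [← hi, mul_apply_eq_comp, ← ContinuousLinearMap.adjoint_inner_left,
      ← ContinuousLinearMap.star_eq_adjoint, hs]
    exact inner_self_nonneg (𝕜 := ℂ)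
  filter_upwards [h1, h2, bddOp_simpleFunc E (normSqApprox f n),
    simpleOp_map E q fun c => (c.toReal : ℂ)] with ω h3 h4 h5 h6
  rw [h5, normSqApprox, ← hq, h6, sum_apply, inner_sum, Complex.re_sum,
    ENNReal.ofReal_sum_of_nonneg]
  · refine Finset.sum_congr rfl fun c hc => ?_
    have hct : c ≠ ∞ := by
      obtain ⟨γ, rfl⟩ := SimpleFunc.mem_range.1 hc
      exact (SimpleFunc.eapprox_lt_top _ n γ).ne
    rw [h3 c hc, smul_apply, inner_smul_right, Complex.re_ofReal_mul,
      ENNReal.ofReal_mul ENNReal.toReal_nonneg, ENNReal.ofReal_toReal hct]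
  · intro c hc
    rw [smul_apply, inner_smul_right, Complex.re_ofReal_mul]
    exact mul_nonneg ENNReal.toReal_nonneg (h4 c hc)

theorem isBddMeasurable_norm_sq {u : Γ → ℂ} (hu : IsBddMeasurable u) :
    IsBddMeasurable fun γ => ((‖u γ‖ ^ 2 : ℝ) : ℂ) := by
  have : (fun γ => ((‖u γ‖ ^ 2 : ℝ) : ℂ)) = fun γ => star (u γ) * u γ := by
    ext γ
    rw [Complex.star_def, Complex.conj_mul', Complex.ofReal_pow]
  rw [this]
  exact hu.star.mul hu

theorem restrict_normSqApprox_eq (f : Γ → OnePoint ℂ) {σ : Set Γ} (hσ : MeasurableSet σ) (n : ℕ) :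
    ((normSqApprox f n).restrict σ : Γ → ℂ) = fun γ => ((σ.indicator (fun γ =>
      (SimpleFunc.eapprox (fun γ => absInfty (f γ) ^ 2) n γ).toReal) γ : ℝ) : ℂ) := by
  ext γ
  by_cases hγ : γ ∈ σ <;> simp [hσ, hγ, normSqApprox]

theorem IsBoundingSeq.inner_restrict_le (h : IsBoundingSeq E f σ)
    (hf : @Measurable Γ (OnePoint ℂ) _ (borel (OnePoint ℂ)) f) : ∀ᵐ ω ∂P, ∀ m n x,
      (inner ℂ x (bddOp E ((normSqApprox f n).restrict (σ m)) ω x)).re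
        ≤ ‖bddOp E (trunc f (σ m)) ω x‖ ^ 2 := by
  simp only [ae_all_iff (ι := ℕ)]
  intro m n
  obtain ⟨C, hC⟩ := h.bounded m
  have hb := h.isBddMeasurable_trunc hf m
  have hs := isBddMeasurable_simpleFunc ((normSqApprox f n).restrict (σ m))
  rw [restrict_normSqApprox_eq f (h.measurableSet m)] at hs ⊢
  filter_upwards [inner_bddOp_mono E hs (isBddMeasurable_norm_sq hb)
    (indicator_normSqApprox_le hf hC n), inner_bddOp_norm_sq E hb] with ω h1 h2 x
  rw [← h2]
  exact h1 x

theorem IsBoundingSeq.inner_restrict_le' (h : IsBoundingSeq E f σ) : ∀ᵐ ω ∂P, ∀ m n x,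
      (inner ℂ x (bddOp E ((normSqApprox f n).restrict (σ m)) ω x)).re
        ≤ (inner ℂ x (bddOp E (normSqApprox f n) ω x)).re := by
  simp only [ae_all_iff (ι := ℕ)]
  intro m n
  have hs := isBddMeasurable_simpleFunc ((normSqApprox f n).restrict (σ m))
  rw [restrict_normSqApprox_eq f (h.measurableSet m)] at hs ⊢
  exact inner_bddOp_mono E hs (isBddMeasurable_simpleFunc (normSqApprox f n)) fun γ =>
    Set.indicator_le_self' (fun _ _ => ENNReal.toReal_nonneg) γ

theorem IsBoundingSeq.tendsto_inner_restrict (h : IsBoundingSeq E f σ) : ∀ᵐ ω ∂P, ∀ n x,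
      Tendsto (fun m => (inner ℂ x (bddOp E ((normSqApprox f n).restrict (σ m)) ω x)).re) atTop
        (𝓝 (inner ℂ x (bddOp E (normSqApprox f n) ω x)).re) := by
  have h1 : ∀ᵐ ω ∂P, ∀ n m, bddOp E ((normSqApprox f n).restrict (σ m)) ω
      = projFamily E (σ m) ω * bddOp E (normSqApprox f n) ω := by
    simp only [ae_all_iff]
    intro n m
    rw [SimpleFunc.coe_restrict _ (h.measurableSet m)]
    exact bddOp_indicator E (isBddMeasurable_simpleFunc _) (h.measurableSet m)
  filter_upwards [h1, h.tendsto_projFamily] with ω h2 h3 n x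
  simp only [h2, mul_apply_eq_comp]
  exact (Complex.continuous_re.tendsto _).comp (tendsto_const_nhds.inner (h3 _))

theorem IsBoundingSeq.tendsto_inner_restrict_normSqApprox (h : IsBoundingSeq E f σ)
    (hf : @Measurable Γ (OnePoint ℂ) _ (borel (OnePoint ℂ)) f) : ∀ᵐ ω ∂P, ∀ m x,
      Tendsto (fun n => (inner ℂ x (bddOp E ((normSqApprox f n).restrict (σ m)) ω x)).re) atTop
        (𝓝 (‖bddOp E (trunc f (σ m)) ω x‖ ^ 2)) := by
  refine ae_all_iff.2 fun m => ?_
  obtain ⟨C, hC⟩ := h.bounded m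
  filter_upwards [tendsto_bddOp E (tendstoUniformly_restrict_normSqApprox hf (h.measurableSet m)
    hC), ae_all_iff.2 fun n => bddOp_simpleFunc E ((normSqApprox f n).restrict (σ m)),
    inner_bddOp_norm_sq E (h.isBddMeasurable_trunc hf m)] with ω h1 h2 h3 x
  rw [← h3]
  simp only [h2]
  exact (Complex.continuous_re.tendsto _).comp
    (tendsto_const_nhds.inner (((ContinuousLinearMap.apply ℂ H x).continuous.tendsto _).comp h1))

/-- Let $a_{m,n}$ be the quadratic form at $g(\omega)$ of the `n`-th approximant of $|f|^2$
restricted to $\sigma_m$. It is dominated by its limit in either index: the `n`-th term of the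
random integral as $m\to\infty$, and $\|I(f\chi_{\sigma_m})g\|^2$ as $n\to\infty$. Hence one family
of limits is bounded iff the other is. -/
theorem IsBoundingSeq.memL2_iff (h : IsBoundingSeq E f σ)
    (hf : @Measurable Γ (OnePoint ℂ) _ (borel (OnePoint ℂ)) f) (g : Ω →ₘ[P] H) :
    MemL2 LinearMap.id (extFamily E) f g ↔ ∀ᵐ ω ∂P, ∃ l,
      Tendsto (fun n => bddOp E (trunc f (σ n)) ω (g ω)) atTop (𝓝 l) := by
  refine eventually_congr ?_
  filter_upwards [sum_eapprox_eq E f g, h.inner_restrict_le hf, h.inner_restrict_le',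
    h.tendsto_inner_restrict, h.tendsto_inner_restrict_normSqApprox hf, h.exists_tendsto_iff hf]
    with ω h1 h2 h3 h4 h5 h6
  rw [← h6, randomLIntegral]
  simp only [LinearMap.id_apply, h1]
  constructor
  · intro hS
    set S := ⨆ n, ENNReal.ofReal (inner ℂ (g ω) (bddOp E (normSqApprox f n) ω (g ω))).re
    have h7 : ∀ n, (inner ℂ (g ω) (bddOp E (normSqApprox f n) ω (g ω))).re ≤ S.toReal := fun n => by
      rw [← ENNReal.ofReal_le_iff_le_toReal hS.ne]
      exact le_iSup (fun n =>
        ENNReal.ofReal (inner ℂ (g ω) (bddOp E (normSqApprox f n) ω (g ω))).re) n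
    refine ⟨Real.sqrt S.toReal, fun m => Real.le_sqrt_of_sq_le ?_⟩
    exact le_of_tendsto' (h5 m (g ω)) fun n => (h3 m n (g ω)).trans (h7 n)
  · rintro ⟨C, hC⟩
    refine lt_of_le_of_lt (iSup_le fun n => ?_) (ENNReal.ofReal_lt_top (r := C ^ 2))
    refine ENNReal.ofReal_le_ofReal (le_of_tendsto' (h4 n (g ω)) fun m => ?_)
    exact (h2 m n (g ω)).trans (pow_le_pow_left₀ (norm_nonneg _) (hC m) 2)

end Bounding

/-- On a finite measure space, a.e. convergence implies convergence in measure, so $k(n)$ can be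
chosen with error at least $1/(n+1)$ only on a set of measure below a summable $\delta_n$.
Borel–Cantelli concludes. -/
theorem exists_subseq_ae_tendsto_sub {Ω : Type*} [MeasurableSpace Ω] {P : Measure Ω}
    [IsFiniteMeasure P] {H : Type*} [NormedAddCommGroup H] {w : ℕ → ℕ → Ω → H} {y : ℕ → Ω → H}
    (hw : ∀ n k, AEStronglyMeasurable (w n k) P)
    (h : ∀ n, ∀ᵐ ω ∂P, Tendsto (fun k => w n k ω) atTop (𝓝 (y n ω))) :
    ∃ k : ℕ → ℕ, (∀ n, n ≤ k n) ∧
      ∀ᵐ ω ∂P, Tendsto (fun n => w n (k n) ω - y n ω) atTop (𝓝 0) := by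
  obtain ⟨δ, hδ, hδs⟩ := ENNReal.exists_pos_sum_of_countable one_ne_zero ℕ
  have hk : ∀ n : ℕ, ∃ k, n ≤ k ∧
      P {ω | ENNReal.ofReal (1 / ((n : ℝ) + 1)) ≤ edist (w n k ω) (y n ω)} < δ n := by
    intro n
    have h1 := tendstoInMeasure_of_tendsto_ae (hw n) (h n) (ENNReal.ofReal (1 / ((n : ℝ) + 1)))
      (ENNReal.ofReal_pos.2 (by positivity))
    obtain ⟨k, hk1, hk2⟩ := ((eventually_ge_atTop n).and
      (h1.eventually_lt_const (ENNReal.coe_pos.2 (hδ n)))).exists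
    exact ⟨k, hk1, hk2⟩
  choose k hk1 hk2 using hk
  refine ⟨k, hk1, ?_⟩
  filter_upwards [ae_eventually_notMem
    ((ENNReal.tsum_le_tsum fun n => (hk2 n).le).trans_lt (hδs.trans ENNReal.one_lt_top)).ne]
    with ω hω
  refine squeeze_zero_norm' ?_ (tendsto_one_div_add_atTop_nhds_zero_nat (𝕜 := ℝ))
  filter_upwards [hω] with n hn
  simp only [not_le] at hn
  rw [edist_eq_enorm_sub, ← ofReal_norm] at hn
  exact ((ENNReal.ofReal_lt_ofReal_iff (by positivity)).1 hn).le

/-! ### Graphs of compositions and restrictions. -/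

section PartialMaps

variable {Ω : Type*} [MeasurableSpace Ω] {P : Measure Ω}
  {H : Type*} [NormedAddCommGroup H] [InnerProductSpace ℂ H]

theorem mem_graph_randComp {V : Type*} [AddCommGroup V] [Module ℂ V]
    (B : (Ω →ₘ[P] H) →ₗ.[ℂ] (Ω →ₘ[P] H)) (A : V →ₗ.[ℂ] (Ω →ₘ[P] H)) (x : V) (h : Ω →ₘ[P] H) :
    (x, h) ∈ (randComp B A).graph ↔ ∃ y, (x, y) ∈ A.graph ∧ (y, h) ∈ B.graph := by
  constructor
  · intro hx
    obtain ⟨v, rfl, rfl⟩ := (LinearPMap.mem_graph_iff _).1 hx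
    exact ⟨_, A.mem_graph ⟨v, randComp_mem_left B A v.2⟩,
      B.mem_graph ⟨_, randComp_mem_right B A v.2⟩⟩
  · rintro ⟨y, hxy, hyh⟩
    obtain ⟨v, rfl, rfl⟩ := (LinearPMap.mem_graph_iff _).1 hxy
    obtain ⟨w, hw, rfl⟩ := (LinearPMap.mem_graph_iff _).1 hyh
    obtain ⟨w, hwB⟩ := w
    obtain rfl : w = A v := hw
    exact (LinearPMap.mem_graph_iff _).2 ⟨⟨v, v, hwB, rfl⟩, rfl, rfl⟩

theorem mem_graph_toPMap_top {V W : Type*} [AddCommGroup V] [Module ℂ V] [AddCommGroup W]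
    [Module ℂ W] (A : V →ₗ[ℂ] W) (x : V) (y : W) :
    (x, y) ∈ (A.toPMap ⊤).graph ↔ A x = y := by
  simp [LinearPMap.mem_graph_iff]

theorem mem_graph_domRestrict {V W : Type*} [AddCommGroup V] [Module ℂ V] [AddCommGroup W]
    [Module ℂ W] (S : V →ₗ.[ℂ] W) (D : Submodule ℂ V) (p : V × W) :
    p ∈ (S.domRestrict D).graph ↔ p.1 ∈ D ∧ p ∈ S.graph := by
  constructor
  · intro hp
    refine ⟨?_, LinearPMap.le_graph_of_le LinearPMap.domRestrict_le hp⟩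
    exact ((LinearPMap.mem_domain_of_mem_graph (x := p.1) (y := p.2) hp) :
      p.1 ∈ D ⊓ S.domain).1
  · rintro ⟨hD, hp⟩
    obtain ⟨v, hv, hv'⟩ := (LinearPMap.mem_graph_iff _).1 hp
    refine (LinearPMap.mem_graph_iff _).2 ⟨⟨p.1, hD, hv ▸ v.2⟩, rfl, ?_⟩
    rw [← hv']
    exact LinearPMap.domRestrict_apply hv.symm

theorem scalarMul_apply_ae (φ : Ω →ₘ[P] ℂ) (g : Ω →ₘ[P] H) :
    ∀ᵐ ω ∂P, scalarMul φ g ω = φ ω • g ω :=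
  AEEqFun.coeFn_comp₂ _ _ _ _

end PartialMaps

/-! ### The limit operator: graph, closedness and core. -/

section Limits

variable {Γ : Type*} [MeasurableSpace Γ] {Ω : Type*} [MeasurableSpace Ω] {P : Measure Ω}
  {H : Type*} [NormedAddCommGroup H] [InnerProductSpace ℂ H]
  {E : RandomSpectralMeasure Γ P H} {f : Γ → OnePoint ℂ} {σ τ : ℕ → Set Γ}

/-- `h = lim I(f χ_{σ_n}) g` almost everywhere. -/
def IsLim (E : RandomSpectralMeasure Γ P H) (f : Γ → OnePoint ℂ) (σ : ℕ → Set Γ)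
    (g h : Ω →ₘ[P] H) : Prop :=
  ∀ᵐ ω ∂P, Tendsto (fun n => bddOp E (trunc f (σ n)) ω (g ω)) atTop (𝓝 (h ω))

theorem IsLim.unique {g h h' : Ω →ₘ[P] H} (H1 : IsLim E f σ g h) (H2 : IsLim E f σ g h') :
    h = h' := by
  refine AEEqFun.ext ?_
  filter_upwards [H1, H2] with ω h1 h2 using tendsto_nhds_unique h1 h2

theorem IsLim.scalarMul {g h : Ω →ₘ[P] H} (H1 : IsLim E f σ g h) (φ : Ω →ₘ[P] ℂ) :
    IsLim E f σ (scalarMul φ g) (scalarMul φ h) := by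
  filter_upwards [H1, scalarMul_apply_ae φ g, scalarMul_apply_ae φ h] with ω h1 h2 h3
  simp only [h2, h3, map_smul]
  exact h1.const_smul _

/-- The graph of the limit operator. -/
def limGraph {V : Type*} [AddCommGroup V] [Module ℂ V] (E : RandomSpectralMeasure Γ P H)
    (f : Γ → OnePoint ℂ) (σ : ℕ → Set Γ) (J : V →ₗ[ℂ] (Ω →ₘ[P] H)) :
    Submodule ℂ (V × (Ω →ₘ[P] H)) where
  carrier := {p | IsLim E f σ (J p.1) p.2}
  add_mem' := by
    rintro ⟨v, h⟩ ⟨v', h'⟩ H1 H2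
    dsimp only [Prod.mk_add_mk, Set.mem_ofPred_eq] at *
    filter_upwards [H1, H2, AEEqFun.coeFn_add (J v) (J v'), AEEqFun.coeFn_add h h']
      with ω h1 h2 h3 h4
    rw [map_add, h3, h4]
    simp only [Pi.add_apply, map_add]
    exact h1.add h2
  zero_mem' := by
    change IsLim E f σ (J 0) 0
    filter_upwards [AEEqFun.coeFn_zero (α := Ω) (β := H) (μ := P)] with ω h1
    rw [map_zero, h1]
    simp
  smul_mem' := by
    rintro c ⟨v, h⟩ H1
    dsimp only [Prod.smul_mk, Set.mem_ofPred_eq] at *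
    filter_upwards [H1, AEEqFun.coeFn_smul c (J v), AEEqFun.coeFn_smul c h] with ω h1 h2 h3
    rw [map_smul, h2, h3]
    simp only [Pi.smul_apply, map_smul]
    exact h1.const_smul c

/-- Decomposability gives $\mathbf E(\sigma_n)s=\sum_c\chi_{\{s=c\}}E(\sigma_n)c$, a finite sum of
the required kind. -/
theorem extFamily_mk_simpleFunc_mem (hσ : IsBoundingSeq E f σ) (n : ℕ) (s : SimpleFunc Ω H) :
    extFamily E (σ n) (AEEqFun.mk s s.aestronglyMeasurable) ∈ tensorUnionRange E σ := by
  classical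
  let χ : H → Ω →ₘ[P] ℂ := fun c => AEEqFun.mk ((s ⁻¹' {c}).indicator fun _ => (1 : ℂ))
    (aestronglyMeasurable_const.indicator (s.measurableSet_fiber c))
  have h : extFamily E (σ n) (AEEqFun.mk s s.aestronglyMeasurable)
      = ∑ c ∈ s.range, scalarMul (χ c) (E.toFun (σ n) c) := by
    refine AEEqFun.ext ?_
    have h1 : ∀ᵐ ω ∂P, ∀ c ∈ s.range, scalarMul (χ c) (E.toFun (σ n) c) ω
        = (s ⁻¹' {c}).indicator (fun _ => (1 : ℂ)) ω • projFamily E (σ n) ω c := by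
      refine (Finset.eventually_all _).2 fun c _ => ?_
      filter_upwards [scalarMul_apply_ae (χ c) (E.toFun (σ n) c), AEEqFun.coeFn_mk
        ((s ⁻¹' {c}).indicator fun _ => (1 : ℂ))
        (aestronglyMeasurable_const.indicator (s.measurableSet_fiber c)),
        isDecomposedBy_projFamily E (hσ.measurableSet n) c] with ω h2 h3 h4
      rw [h2, h3, h4]
    filter_upwards [extFamily_apply_ae E (hσ.measurableSet n)
      (AEEqFun.mk s s.aestronglyMeasurable), AEEqFun.coeFn_mk s s.aestronglyMeasurable,
      AEEqFun.coeFn_finsetSum s.range fun c => scalarMul (χ c) (E.toFun (σ n) c), h1]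
      with ω h2 h3 h4 h5
    rw [h2, h3, h4, Finset.sum_apply, Finset.sum_congr rfl h5,
      Finset.sum_eq_single_of_mem (s ω) (s.mem_range_self ω)]
    · simp
    · intro c _ hc
      have : s ω ≠ c := hc.symm
      simp [this]
  rw [h]
  exact Submodule.sum_mem _ fun c _ => Submodule.subset_span ⟨_, _, ⟨n, c, rfl⟩, rfl⟩

variable [TopologicalSpace.SeparableSpace H]

/-- The sets $\{|f|\le n\}$ exhaust the complement of $\{f=\infty\}$, and that set carries no mass.
-/
theorem exists_isBoundingSeq (hf : @Measurable Γ (OnePoint ℂ) _ (borel (OnePoint ℂ)) f)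
    (hfin : E.toFun (f ⁻¹' {OnePoint.infty}) = 0) : ∃ σ, IsBoundingSeq E f σ := by
  have hm := measurable_absInfty_comp hf
  have hinf : f ⁻¹' {OnePoint.infty} = {γ | absInfty (f γ) = ∞} := by
    ext γ
    simp only [Set.mem_preimage, Set.mem_singleton_iff, Set.mem_ofPred_eq]
    generalize f γ = z
    induction z using OnePoint.rec <;> simp [absInfty]
  have hmi : MeasurableSet (f ⁻¹' {OnePoint.infty}) := by
    rw [hinf]
    exact hm (measurableSet_singleton ∞)
  refine ⟨fun n => {γ | absInfty (f γ) ≤ n}, fun n => hm measurableSet_Iic,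
    fun n => ⟨n, fun γ hγ => by simpa using hγ⟩, fun n γ hγ => ?_, ?_⟩
  · have h : absInfty (f γ) ≤ n := hγ
    exact h.trans (by exact_mod_cast Nat.le_succ n : (n : ℝ≥0∞) ≤ (n + 1 : ℕ))
  · have hU : ⋃ n : ℕ, {γ | absInfty (f γ) ≤ n} = (f ⁻¹' {OnePoint.infty})ᶜ := by
      ext γ
      rw [hinf]
      simp only [Set.mem_iUnion, Set.mem_ofPred_eq, Set.mem_compl_iff]
      constructor
      · rintro ⟨n, hn⟩ h
        simp [h] at hn
      · intro h
        obtain ⟨n, hn⟩ := ENNReal.exists_nat_gt h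
        exact ⟨n, hn.le⟩
    rw [hU]
    ext1 x
    refine AEEqFun.ext ?_
    have h0 : ∀ᵐ ω ∂P, E.toFun (f ⁻¹' {OnePoint.infty}) x ω = 0 := by
      rw [hfin]
      exact AEEqFun.coeFn_zero
    filter_upwards [h0, isDecomposedBy_projFamily E hmi x,
      isDecomposedBy_projFamily E hmi.compl x, projFamily_univ E, constMap_apply_ae P x,
      projFamily_union E hmi hmi.compl disjoint_compl_right] with ω h1 h2 h3 h4 h5 h6
    rw [Set.union_compl_self, h4] at h6
    have h7 := congrArg (fun A : H →L[ℂ] H => A x) h6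
    simp only [one_apply_eq_self, add_apply] at h7
    rw [← h2, h1, zero_add] at h7
    rw [h3, h5, ← h7]

variable [CompleteSpace H]

theorem exists_isLim_iff (hf : @Measurable Γ (OnePoint ℂ) _ (borel (OnePoint ℂ)) f)
    (hσ : IsBoundingSeq E f σ) (g : Ω →ₘ[P] H) :
    (∃ h, IsLim E f σ g h) ↔ MemL2 LinearMap.id (extFamily E) f g := by
  rw [hσ.memL2_iff hf]
  constructor
  · rintro ⟨h, hh⟩
    filter_upwards [hh] with ω hω using ⟨_, hω⟩
  · intro h
    have hm : ∀ n, AEStronglyMeasurable (fun ω => bddOp E (trunc f (σ n)) ω (g ω)) P := fun n =>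
      (integral (extFamily E) (trunc f (σ n)) g).aestronglyMeasurable.congr
        (integral_extFamily_apply_ae E (hσ.isBddMeasurable_trunc hf n) g)
    have hl : ∀ᵐ ω ∂P, Tendsto (fun n => bddOp E (trunc f (σ n)) ω (g ω)) atTop
        (𝓝 (limUnder atTop fun n => bddOp E (trunc f (σ n)) ω (g ω))) := by
      filter_upwards [h] with ω hω using tendsto_nhds_limUnder hω
    refine ⟨AEEqFun.mk _ (aestronglyMeasurable_of_tendsto_ae atTop hm hl), ?_⟩
    filter_upwards [hl, AEEqFun.coeFn_mk _ (aestronglyMeasurable_of_tendsto_ae atTop hm hl)]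
      with ω h1 h2
    rwa [h2]

/-- $E(\tau_n)h=\lim_m E(\tau_n)I(f\chi_{\sigma_m})g=\lim_m
E(\sigma_m)I(f\chi_{\tau_n})g=I(f\chi_{\tau_n})g$, as $E(\sigma_m)\to 1$ strongly. -/
theorem IsLim.projFamily_apply (hf : @Measurable Γ (OnePoint ℂ) _ (borel (OnePoint ℂ)) f)
    (hσ : IsBoundingSeq E f σ) (hτ : IsBoundingSeq E f τ) {g h : Ω →ₘ[P] H}
    (H1 : IsLim E f σ g h) :
    ∀ᵐ ω ∂P, ∀ n, projFamily E (τ n) ω (h ω) = bddOp E (trunc f (τ n)) ω (g ω) := by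
  filter_upwards [H1, projFamily_mul_bddOp_trunc hf hσ hτ, hσ.tendsto_projFamily]
    with ω h1 h2 h3 n
  refine tendsto_nhds_unique (((projFamily E (τ n) ω).continuous.tendsto _).comp h1)
    ((h3 (bddOp E (trunc f (τ n)) ω (g ω))).congr fun m => ?_)
  rw [← mul_apply_eq_comp, h2 m n]
  rfl

theorem isLim_of_projFamily_apply (hσ : IsBoundingSeq E f σ) {g h : Ω →ₘ[P] H}
    (H1 : ∀ᵐ ω ∂P, ∀ n, projFamily E (σ n) ω (h ω) = bddOp E (trunc f (σ n)) ω (g ω)) :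
    IsLim E f σ g h := by
  filter_upwards [H1, hσ.tendsto_projFamily] with ω h1 h2
  simpa only [h1] using h2 (h ω)

theorem IsLim.of_isBoundingSeq (hf : @Measurable Γ (OnePoint ℂ) _ (borel (OnePoint ℂ)) f)
    (hσ : IsBoundingSeq E f σ) (hτ : IsBoundingSeq E f τ) {g h : Ω →ₘ[P] H}
    (H1 : IsLim E f σ g h) : IsLim E f τ g h :=
  isLim_of_projFamily_apply hτ (H1.projFamily_apply hf hσ hτ)

theorem isLim_extFamily (hf : @Measurable Γ (OnePoint ℂ) _ (borel (OnePoint ℂ)) f)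
    (hσ : IsBoundingSeq E f σ) (g : Ω →ₘ[P] H) (n : ℕ) :
    IsLim E f σ (extFamily E (σ n) g) (integral (extFamily E) (trunc f (σ n)) g) := by
  filter_upwards [extFamily_apply_ae E (hσ.measurableSet n) g,
    integral_extFamily_apply_ae E (hσ.isBddMeasurable_trunc hf n) g,
    bddOp_trunc_mul_projFamily_of_le hf hσ] with ω h1 h2 h3
  rw [h1, h2]
  refine tendsto_const_nhds.congr' ?_
  filter_upwards [eventually_ge_atTop n] with m hm
  rw [← h3 n m hm]
  rfl

theorem isLim_toFun (hf : @Measurable Γ (OnePoint ℂ) _ (borel (OnePoint ℂ)) f)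
    (hσ : IsBoundingSeq E f σ) (x : H) (n : ℕ) :
    IsLim E f σ (E.toFun (σ n) x) (integral E.toFun (trunc f (σ n)) x) := by
  rw [← extFamily_constMap E (hσ.measurableSet n),
    ← integral_extFamily_constMap E (hσ.isBddMeasurable_trunc hf n)]
  exact isLim_extFamily hf hσ _ n

theorem IsLim.extFamily_eq (hf : @Measurable Γ (OnePoint ℂ) _ (borel (OnePoint ℂ)) f)
    (hσ : IsBoundingSeq E f σ) {g h : Ω →ₘ[P] H} (H1 : IsLim E f σ g h) (n : ℕ) :
    extFamily E (σ n) h = integral (extFamily E) (trunc f (σ n)) g := by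
  refine AEEqFun.ext ?_
  filter_upwards [extFamily_apply_ae E (hσ.measurableSet n) h,
    integral_extFamily_apply_ae E (hσ.isBddMeasurable_trunc hf n) g,
    H1.projFamily_apply hf hσ hσ] with ω h1 h2 h3
  rw [h1, h2, h3]

/-- Closedness of the graph: along a common a.e. convergent subsequence, each equation
$E(\sigma_n)v_k=I(f\chi_{\sigma_n})u_k$ passes to the limit by continuity of both operators. -/
theorem isLim_of_tendstoInMeasure (hf : @Measurable Γ (OnePoint ℂ) _ (borel (OnePoint ℂ)) f)
    (hσ : IsBoundingSeq E f σ) {u v : ℕ → Ω →ₘ[P] H} (huv : ∀ k, IsLim E f σ (u k) (v k))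
    {g h : Ω →ₘ[P] H} (hu : TendstoInMeasure P (fun k => (u k : Ω → H)) atTop g)
    (hv : TendstoInMeasure P (fun k => (v k : Ω → H)) atTop h) : IsLim E f σ g h := by
  obtain ⟨ns, hns, hu'⟩ := hu.exists_seq_tendsto_ae
  obtain ⟨ms, hms, hv'⟩ := (hv.comp hns.tendsto_atTop).exists_seq_tendsto_ae
  refine isLim_of_projFamily_apply hσ ?_
  filter_upwards [hu', hv', ae_all_iff.2 fun k => (huv k).projFamily_apply hf hσ hσ]
    with ω h1 h2 h3 n
  refine tendsto_nhds_unique (((projFamily E (σ n) ω).continuous.tendsto _).comp h2) ?_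
  refine (((bddOp E (trunc f (σ n)) ω).continuous.tendsto _).comp
    (h1.comp hms.tendsto_atTop)).congr fun k => ?_
  exact (h3 _ n).symm

/-- One bounding sequence already determines the operator, domain included. All later claims thus
become claims about `IsLim`, treated at once for `H` and for random vectors. -/
theorem isUnboundedIntegral_iff {V : Type*} [AddCommGroup V] [Module ℂ V]
    {J : V →ₗ[ℂ] (Ω →ₘ[P] H)} {F : Set Γ → V →ₗ[ℂ] (Ω →ₘ[P] H)}
    (hf : @Measurable Γ (OnePoint ℂ) _ (borel (OnePoint ℂ)) f)
    (hF : ∀ u, IsBddMeasurable u → ∀ v, ∀ᵐ ω ∂P, integral F u v ω = bddOp E u ω (J v ω))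
    (hM : ∀ v, MemL2 J F f v ↔ MemL2 LinearMap.id (extFamily E) f (J v))
    (hσ : IsBoundingSeq E f σ) (T : V →ₗ.[ℂ] (Ω →ₘ[P] H)) :
    IsUnboundedIntegral E J F f T ↔ T.graph = limGraph E f σ J := by
  have hint : ∀ {τ}, IsBoundingSeq E f τ → ∀ v h, (∀ᵐ ω ∂P, Tendsto
      (fun n => integral F (trunc f (τ n)) v ω) atTop (𝓝 (h ω))) ↔ IsLim E f τ (J v) h := by
    intro τ hτ v h
    refine eventually_congr ?_
    filter_upwards [ae_all_iff.2 fun n => hF _ (hτ.isBddMeasurable_trunc hf n) v] with ω h1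
    simp only [h1]
  constructor
  · rintro ⟨h1, h2⟩
    ext ⟨v, h⟩
    constructor
    · intro hv
      obtain ⟨w, rfl, rfl⟩ := (LinearPMap.mem_graph_iff _).1 hv
      exact (hint hσ _ _).1 (h2 w σ hσ)
    · intro hv
      have hd : v ∈ T.domain := (h1 v).2 ((hM v).2 ((exists_isLim_iff hf hσ _).1 ⟨h, hv⟩))
      have he : T ⟨v, hd⟩ = h := ((hint hσ _ _).1 (h2 ⟨v, hd⟩ σ hσ)).unique hv
      rw [← he]
      exact T.mem_graph ⟨v, hd⟩
  · intro hT
    refine ⟨fun v => ?_, fun v τ hτ => ?_⟩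
    · rw [LinearPMap.mem_domain_iff, hM, ← exists_isLim_iff hf hσ, hT]
      rfl
    · have hv : ((v : V), T v) ∈ limGraph E f σ J := hT ▸ T.mem_graph v
      exact (hint hτ _ _).2 (IsLim.of_isBoundingSeq hf hσ hτ hv)

theorem existsUnique_isUnboundedIntegral {V : Type*} [AddCommGroup V] [Module ℂ V]
    {J : V →ₗ[ℂ] (Ω →ₘ[P] H)} {F : Set Γ → V →ₗ[ℂ] (Ω →ₘ[P] H)}
    (hf : @Measurable Γ (OnePoint ℂ) _ (borel (OnePoint ℂ)) f)
    (hF : ∀ u, IsBddMeasurable u → ∀ v, ∀ᵐ ω ∂P, integral F u v ω = bddOp E u ω (J v ω))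
    (hM : ∀ v, MemL2 J F f v ↔ MemL2 LinearMap.id (extFamily E) f (J v))
    (hσ : IsBoundingSeq E f σ) : ∃! T : V →ₗ.[ℂ] (Ω →ₘ[P] H), IsUnboundedIntegral E J F f T := by
  simp only [isUnboundedIntegral_iff hf hF hM hσ]
  refine ⟨(limGraph E f σ J).toLinearPMap, Submodule.toLinearPMap_graph_eq _ ?_, fun T hT => ?_⟩
  · rintro ⟨v, h⟩ hv (rfl : v = 0)
    exact IsLim.unique (hv : IsLim E f σ (J 0) h) (limGraph E f σ J).zero_mem
  · refine LinearPMap.eq_of_eq_graph (hT.trans (Submodule.toLinearPMap_graph_eq _ ?_).symm)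
    rintro ⟨v, h⟩ hv (rfl : v = 0)
    exact IsLim.unique (hv : IsLim E f σ (J 0) h) (limGraph E f σ J).zero_mem

theorem isRandomIntegral_iff (hf : @Measurable Γ (OnePoint ℂ) _ (borel (OnePoint ℂ)) f)
    (hσ : IsBoundingSeq E f σ) (T : H →ₗ.[ℂ] (Ω →ₘ[P] H)) :
    IsRandomIntegral E f T ↔ T.graph = limGraph E f σ (constMap P H) := by
  refine isUnboundedIntegral_iff hf (fun u hu x => ?_) (memL2_toFun_iff E f) hσ T
  filter_upwards [integral_toFun_apply_ae E hu x, constMap_apply_ae P x] with ω h1 h2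
  rw [h1, h2]

theorem isExtRandomIntegral_iff (hf : @Measurable Γ (OnePoint ℂ) _ (borel (OnePoint ℂ)) f)
    (hσ : IsBoundingSeq E f σ) (S : (Ω →ₘ[P] H) →ₗ.[ℂ] (Ω →ₘ[P] H)) :
    IsExtRandomIntegral E f S ↔ S.graph = limGraph E f σ LinearMap.id :=
  isUnboundedIntegral_iff hf (fun _ hu => integral_extFamily_apply_ae E hu) (fun _ => Iff.rfl) hσ S

/-- Applying $\mathbf E(\sigma_n)$ to simple approximations of `g` gives elements of the core whose
images are $\mathbf I(f\chi_{\sigma_n})s_k$. -/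
theorem IsLim.exists_tendsto [IsFiniteMeasure P]
    (hf : @Measurable Γ (OnePoint ℂ) _ (borel (OnePoint ℂ)) f) (hσ : IsBoundingSeq E f σ)
    {g h : Ω →ₘ[P] H} (H1 : IsLim E f σ g h) : ∃ u v : ℕ → Ω →ₘ[P] H,
      (∀ n, u n ∈ tensorUnionRange E σ ∧ IsLim E f σ (u n) (v n)) ∧
      TendstoInMeasure P (fun n => (u n : Ω → H)) atTop g ∧
      TendstoInMeasure P (fun n => (v n : Ω → H)) atTop h := by
  let s := g.stronglyMeasurable.approx
  have hs : ∀ ω, Tendsto (fun k => s k ω) atTop (𝓝 (g ω)) := g.stronglyMeasurable.tendsto_approx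
  let w : ℕ → Ω →ₘ[P] H := fun k => AEEqFun.mk (s k) (s k).aestronglyMeasurable
  have hw : ∀ᵐ ω ∂P, ∀ k, w k ω = s k ω := ae_all_iff.2 fun k => AEEqFun.coeFn_mk _ _
  have hint : ∀ᵐ ω ∂P, ∀ n k, integral (extFamily E) (trunc f (σ n)) (w k) ω
      = bddOp E (trunc f (σ n)) ω (w k ω) := by
    simp only [ae_all_iff]
    exact fun n k => integral_extFamily_apply_ae E (hσ.isBddMeasurable_trunc hf n) (w k)
  have hext : ∀ᵐ ω ∂P, ∀ n k, extFamily E (σ n) (w k) ω = projFamily E (σ n) ω (w k ω) := by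
    simp only [ae_all_iff]
    exact fun n k => extFamily_apply_ae E (hσ.measurableSet n) (w k)
  -- The norms of $I(f\chi_{\sigma_n})$ may grow with `n`, so the index of the simple approximation
  -- has to be chosen for each `n`.
  obtain ⟨k, hk, hkt⟩ := exists_subseq_ae_tendsto_sub (P := P)
    (w := fun n k => integral (extFamily E) (trunc f (σ n)) (w k))
    (y := fun n ω => bddOp E (trunc f (σ n)) ω (g ω))
    (fun n k => (integral (extFamily E) (trunc f (σ n)) (w k)).aestronglyMeasurable) (by
      intro n
      filter_upwards [hw, hint] with ω h1 h2
      simp only [h2, h1]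
      exact ((bddOp E (trunc f (σ n)) ω).continuous.tendsto _).comp (hs ω))
  refine ⟨fun n => extFamily E (σ n) (w (k n)),
    fun n => integral (extFamily E) (trunc f (σ n)) (w (k n)), fun n =>
    ⟨extFamily_mk_simpleFunc_mem hσ n _, isLim_extFamily hf hσ _ n⟩,
    tendstoInMeasure_of_tendsto_ae (fun n => AEEqFun.aestronglyMeasurable _) ?_,
    tendstoInMeasure_of_tendsto_ae (fun n => AEEqFun.aestronglyMeasurable _) ?_⟩
  · filter_upwards [hw, hext, hσ.tendsto_projFamily,
      ae_all_iff.2 fun n => norm_projFamily_le E (hσ.measurableSet n)] with ω h1 h2 h3 h4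
    simp only [h2, h1]
    exact tendsto_of_norm_le_one h4 ((hs ω).comp (tendsto_atTop_mono hk tendsto_id)) (h3 _)
  · filter_upwards [hkt, H1] with ω h1 h2
    simpa using h1.add h2

end Limits

end

end RandomOp

/-! ### Assembly of the theorem. -/

theorem mainTheorem5 {Ω : Type*} [MeasurableSpace Ω] (P : Measure Ω) [IsProbabilityMeasure P]
    {Γ : Type*} [MeasurableSpace Γ]
    {H : Type*} [NormedAddCommGroup H] [InnerProductSpace ℂ H] [CompleteSpace H]
    [TopologicalSpace.SeparableSpace H]
    (E : RandomOp.RandomSpectralMeasure Γ P H) (f : Γ → OnePoint ℂ)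
    (hf : @Measurable Γ (OnePoint ℂ) _ (borel (OnePoint ℂ)) f)
    (hfin : E.toFun (f ⁻¹' {OnePoint.infty}) = 0) :
    -- the integrals of bounded measurable functions exist
    (∀ u : Γ → ℂ, Measurable u → (∃ C : ℝ, ∀ γ, ‖u γ‖ ≤ C) →
      RandomOp.IsBoundedIntegral E.toFun u (RandomOp.integral E.toFun u) ∧
      RandomOp.IsBoundedIntegral (RandomOp.extFamily E) u
        (RandomOp.integral (RandomOp.extFamily E) u)) ∧
    -- the domain through bounding sequences
    (∀ x : H, RandomOp.MemL2 (RandomOp.constMap P H) E.toFun f x ↔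
      ∀ σ : ℕ → Set Γ, RandomOp.IsBoundingSeq E f σ →
        ∀ᵐ ω ∂P, ∃ l : H, Tendsto
          (fun n => RandomOp.integral E.toFun (RandomOp.trunc f (σ n)) x ω) atTop (𝓝 l)) ∧
    -- the limit is correctly defined, on `H` and for the action on random vectors
    (∃! T : H →ₗ.[ℂ] (Ω →ₘ[P] H), RandomOp.IsRandomIntegral E f T) ∧
    (∃! S : (Ω →ₘ[P] H) →ₗ.[ℂ] (Ω →ₘ[P] H), RandomOp.IsExtRandomIntegral E f S) ∧
    ∀ (T : H →ₗ.[ℂ] (Ω →ₘ[P] H)) (S : (Ω →ₘ[P] H) →ₗ.[ℂ] (Ω →ₘ[P] H)),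
      RandomOp.IsRandomIntegral E f T → RandomOp.IsExtRandomIntegral E f S →
      -- `S` is decomposable, and `T` is its part in `H`
      (∀ (φ : Ω →ₘ[P] ℂ) (g h : Ω →ₘ[P] H), (g, h) ∈ S.graph →
        (RandomOp.scalarMul φ g, RandomOp.scalarMul φ h) ∈ S.graph) ∧
      (∀ (x : H) (h : Ω →ₘ[P] H),
        (x, h) ∈ T.graph ↔ (RandomOp.constMap P H x, h) ∈ S.graph) ∧
      -- cores and products with the projections `E(σ n)`
      ∀ σ : ℕ → Set Γ, RandomOp.IsBoundingSeq E f σ →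
        RandomOp.unionRange E σ ⊆ S.domain ∧
        RandomOp.IsCore S (RandomOp.tensorUnionRange E σ) ∧
        (∀ (x : H) (h : Ω →ₘ[P] H), (x, h) ∈ T.graph ↔
          (RandomOp.constMap P H x, h) ∈ RandomOp.closureInMeasure
            {p | p ∈ S.graph ∧ p.1 ∈ RandomOp.unionRange E σ}) ∧
        ∀ n : ℕ,
          RandomOp.randComp ((RandomOp.extFamily E (σ n)).toPMap ⊤) T ≤
            RandomOp.randComp S ((E.toFun (σ n)).toPMap ⊤) ∧
          RandomOp.randComp S ((E.toFun (σ n)).toPMap ⊤) =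
            (RandomOp.integral E.toFun (RandomOp.trunc f (σ n))).toPMap ⊤ := by
  have hbdd : ∀ {σ : ℕ → Set Γ}, RandomOp.IsBoundingSeq E f σ → ∀ n,
      RandomOp.IsBddMeasurable (RandomOp.trunc f (σ n)) := fun h => h.isBddMeasurable_trunc hf
  obtain ⟨τ, hτ⟩ := RandomOp.exists_isBoundingSeq hf hfin
  refine ⟨fun u hu hC => ⟨RandomOp.isBoundedIntegral_toFun E ⟨hu, hC⟩,
    RandomOp.isBoundedIntegral_extFamily E ⟨hu, hC⟩⟩, fun x => ?_, ?_, ?_, ?_⟩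
  · have h : ∀ σ, RandomOp.IsBoundingSeq E f σ →
        (RandomOp.MemL2 (RandomOp.constMap P H) E.toFun f x ↔ ∀ᵐ ω ∂P, ∃ l : H, Tendsto
          (fun n => RandomOp.integral E.toFun (RandomOp.trunc f (σ n)) x ω) atTop (𝓝 l)) := by
      intro σ hσ
      rw [RandomOp.memL2_toFun_iff, hσ.memL2_iff hf]
      refine eventually_congr ?_
      filter_upwards [RandomOp.constMap_apply_ae P x,
        ae_all_iff.2 fun n => RandomOp.integral_toFun_apply_ae E (hbdd hσ n) x] with ω h1 h2
      simp only [h1, h2]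
    exact ⟨fun hx σ hσ => (h σ hσ).1 hx, fun hx => (h τ hτ).2 (hx τ hτ)⟩
  · refine RandomOp.existsUnique_isUnboundedIntegral hf (fun u hu x => ?_)
      (RandomOp.memL2_toFun_iff E f) hτ
    filter_upwards [RandomOp.integral_toFun_apply_ae E hu x, RandomOp.constMap_apply_ae P x]
      with ω h1 h2
    rw [h1, h2]
  · exact RandomOp.existsUnique_isUnboundedIntegral hf
      (fun _ hu => RandomOp.integral_extFamily_apply_ae E hu) (fun _ => Iff.rfl) hτ
  · intro T S hT hS
    have hTg : ∀ {σ}, RandomOp.IsBoundingSeq E f σ → ∀ x h,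
        (x, h) ∈ T.graph ↔ RandomOp.IsLim E f σ (RandomOp.constMap P H x) h := by
      intro σ hσ x h
      rw [(RandomOp.isRandomIntegral_iff hf hσ T).1 hT]
      rfl
    have hSg : ∀ {σ}, RandomOp.IsBoundingSeq E f σ → ∀ g h,
        (g, h) ∈ S.graph ↔ RandomOp.IsLim E f σ g h := by
      intro σ hσ g h
      rw [(RandomOp.isExtRandomIntegral_iff hf hσ S).1 hS]
      rfl
    refine ⟨fun φ g h hgh => ?_, fun x h => ?_, fun σ hσ => ?_⟩
    · rw [hSg hτ] at hgh ⊢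
      exact hgh.scalarMul φ
    · rw [hTg hτ, hSg hτ]
    have hU : RandomOp.unionRange E σ ⊆ S.domain := by
      rintro _ ⟨n, x, rfl⟩
      exact LinearPMap.mem_domain_iff.2 ⟨_, (hSg hσ _ _).2 (RandomOp.isLim_toFun hf hσ x n)⟩
    have hclosed : RandomOp.closureInMeasure (S.graph : Set ((Ω →ₘ[P] H) × (Ω →ₘ[P] H)))
        ⊆ S.graph := by
      rintro ⟨g, h⟩ ⟨u, hu, hu1, hu2⟩
      exact (hSg hσ g h).2
        (RandomOp.isLim_of_tendstoInMeasure hf hσ (fun k => (hSg hσ _ _).1 (hu k)) hu1 hu2)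
    refine ⟨hU, ⟨?_, ?_⟩, fun x h => ⟨fun hx => ?_, fun hx => ?_⟩, fun n => ⟨?_, ?_⟩⟩
    · refine Submodule.span_le.2 ?_
      rintro _ ⟨φ, y, hy, rfl⟩
      obtain ⟨h, hh⟩ := LinearPMap.mem_domain_iff.1 (hU hy)
      exact LinearPMap.mem_domain_iff.2
        ⟨_, (hSg hσ _ _).2 (((hSg hσ _ _).1 hh).scalarMul φ)⟩
    · refine Set.Subset.antisymm ?_ ?_
      · rintro ⟨g, h⟩ hgh
        obtain ⟨u, v, huv, hu, hv⟩ := ((hSg hσ g h).1 hgh).exists_tendsto hf hσ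
        exact ⟨fun n => (u n, v n), fun n => (RandomOp.mem_graph_domRestrict S _ _).2
          ⟨(huv n).1, (hSg hσ _ _).2 (huv n).2⟩, hu, hv⟩
      · rintro p ⟨u, hu, hu1, hu2⟩
        exact hclosed ⟨u, fun k => ((RandomOp.mem_graph_domRestrict S _ _).1 (hu k)).2, hu1, hu2⟩
    -- For constant vectors, the truncations $E(\sigma_n)x$ themselves approximate in the graph,
    -- without random coefficients.
    · rw [hTg hσ] at hx
      refine ⟨fun n => (E.toFun (σ n) x, RandomOp.integral E.toFun (RandomOp.trunc f (σ n)) x),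
        fun n => ⟨(hSg hσ _ _).2 (RandomOp.isLim_toFun hf hσ x n), n, x, rfl⟩,
        tendstoInMeasure_of_tendsto_ae (fun n => AEEqFun.aestronglyMeasurable _) ?_,
        tendstoInMeasure_of_tendsto_ae (fun n => AEEqFun.aestronglyMeasurable _) ?_⟩
      · filter_upwards [hσ.tendsto_projFamily, RandomOp.constMap_apply_ae P x, ae_all_iff.2
          fun n => RandomOp.isDecomposedBy_projFamily E (hσ.measurableSet n) x] with ω h1 h2 h3
        simp only [h2, h3]
        exact h1 x
      · filter_upwards [hx, RandomOp.constMap_apply_ae P x, ae_all_iff.2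
          fun n => RandomOp.integral_toFun_apply_ae E (hbdd hσ n) x] with ω h1 h2 h3
        simpa only [h2, h3] using h1
    · obtain ⟨u, hu, hu1, hu2⟩ := hx
      exact (hTg hσ x h).2 ((hSg hσ _ _).1 (hclosed ⟨u, fun k => (hu k).1, hu1, hu2⟩))
    -- For $x$ in the domain, $\mathbf E(\sigma_n)\tilde I(f)x=I(f\chi_{\sigma_n})x$, which is also
    -- the value of $\tilde{\mathbf I}(f)$ at $E(\sigma_n)x$.
    · refine LinearPMap.le_of_le_graph ?_
      rintro ⟨x, h⟩ hx
      obtain ⟨y, hxy, hyh⟩ := (RandomOp.mem_graph_randComp _ _ _ _).1 hx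
      rw [hTg hσ] at hxy
      rw [RandomOp.mem_graph_toPMap_top, hxy.extFamily_eq hf hσ n,
        RandomOp.integral_extFamily_constMap E (hbdd hσ n)] at hyh
      refine (RandomOp.mem_graph_randComp _ _ _ _).2
        ⟨_, (RandomOp.mem_graph_toPMap_top _ _ _).2 rfl, (hSg hσ _ _).2 ?_⟩
      rw [← hyh]
      exact RandomOp.isLim_toFun hf hσ x n
    · refine LinearPMap.eq_of_eq_graph ?_
      ext ⟨x, h⟩
      simp only [RandomOp.mem_graph_randComp, RandomOp.mem_graph_toPMap_top, hSg hσ,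
        exists_eq_left']
      exact ⟨fun hx => (RandomOp.isLim_toFun hf hσ x n).unique hx,
        fun hx => hx ▸ RandomOp.isLim_toFun hf hσ x n⟩
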